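/- Let $f:(0,\infty)\to\mathbb{R}$ be operator convex with finite limit $f(0^+):=\lim_{x\searrow0}f(x)$ (equivalently, $f$ extends by continuity to an operator convex function on $[0,\infty)$). Here operator convexity means $f(tA+(1-t)B)\le tf(A)+(1-t)f(B)$ for all $t\in[0,1]$ and all positive definite complex matrices $A,B$ of equal, arbitrary finite size. For positive definite $d\times d$ matrices $\varrho,\sigma$ put $$S_f(\varrho\|\sigma):=\operatorname{Tr}\sigma^{1/2}f(L_\varrho R_{\sigma^{-1}})(\sigma^{1/2}),\qquad \widehat S_f(\varrho\|\sigma):=\operatorname{Tr}\sigma^{1/2}f(\sigma^{-1/2}\varrho\sigma^{-1/2})\sigma^{1/2},$$ where $L_\varrho R_{\sigma^{-1}}:X\mapsto\varrho X\sigma^{-1}$ acts on the Hilbert space of $d\times d$ matrices with inner product $\langle X,Y\rangle=\operatorname{Tr}X^*Y$; for positive semidefinite $\varrho,\sigma$ put $S_f(\varrho\|\sigma):=\lim_{\varepsilon\searrow0}S_f(\varrho+\varepsilon I\|\sigma+\varepsilon I)$ and $\widehat S_f(\varrho\|\sigma):=\lim_{\varepsilon\searrow0}\widehat S_f(\varrho+\varepsilon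 I\|\sigma+\varepsilon I)$ (limits in $[-\infty,+\infty]$). Let $\varrho^0$ denote the support projection of $\varrho$. 1. Let $a\in\mathbb{R}$, $b\ge0$ and let $\mu_f$ be a positive measure on $(0,\infty)$ with $\int(1+s)^{-2}\,d\mu_f(s)<\infty$ such that $$f(x)=f(0^+)+ax+bx^2+\int_{(0,\infty)}\Bigl(\frac{x}{1+s}-\frac{x}{x+s}\Bigr)d\mu_f(s),\qquad x>0.$$ Then $f$ is not a polynomial if and only if $\operatorname{supp}\mu_f\neq\emptyset$. 2. Suppose that $f$ is not a polynomial on $(0,\infty)$. Then for all positive semidefinite $2\times2$ complex matrices $\varrho,\gamma$ with $\varrho\gamma\ne\gamma\varrho$ and $\varrho^0\le\gamma^0$, the limits defining $S_f(\varrho\|\gamma)$ and $\widehat S_f(\varrho\|\gamma)$ exist, and $$S_f(\varrho\|\gamma)<\widehat S_f(\varrho\|\gamma).$$ -/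

import Mathlib

open scoped Matrix ComplexOrder Topology
open Filter MeasureTheory

noncomputable section

namespace QuantumDivergence

variable {n : Type*} [Fintype n] [DecidableEq n]

/-- Real powers of a positive semidefinite matrix, taken on its support:
`ρ ^ t = ∑ a ^ t P_a`, the sum over the eigenvalues `a > 0`. In particular `psdPow ρ 0` is the
support projection `ρ⁰`, and `psdPow ρ (-1)` is the generalized inverse. -/
def psdPow (ρ : Matrix n n ℂ) (t : ℝ) : Matrix n n ℂ :=
  cfc (fun x : ℝ => if 0 < x then x ^ t else 0) ρ

/-- `f` is operator convex on `(0, ∞)`: the operator convexity inequality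
`f (tA + (1-t)B) ≤ t f(A) + (1-t) f(B)` holds for positive definite matrices of every size.
Only the values of `f` on `(0, ∞)` matter. -/
def OperatorConvex (f : ℝ → ℝ) : Prop :=
  ∀ (d : ℕ) (A B : Matrix (Fin d) (Fin d) ℂ), A.PosDef → B.PosDef →
    ∀ t : ℝ, 0 ≤ t → t ≤ 1 →
      (t • cfc f A + (1 - t) • cfc f B - cfc f (t • A + (1 - t) • B)).PosSemidef

/-- `f` agrees on `(0, ∞)` with a real polynomial. -/
def IsPolynomial (f : ℝ → ℝ) : Prop :=
  ∃ p : Polynomial ℝ, ∀ x : ℝ, 0 < x → f x = p.eval x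

/-- `(a, b, μ)` represents `f` through
`f(x) = f(0⁺) + a x + b x² + ∫_{(0,∞)} (x/(1+s) - x/(x+s)) dμ(s)` for `x > 0`, where `b ≥ 0` and
`μ` is a positive measure on `(0, ∞)` with `∫ (1+s)⁻² dμ(s) < ∞`. This makes the integrand
integrable for every `x > 0`. -/
structure IsRepresentation (f : ℝ → ℝ) (a b : ℝ) (μ : Measure (Set.Ioi (0 : ℝ))) : Prop where
  nonneg : 0 ≤ b
  integrable : Integrable (fun s : Set.Ioi (0 : ℝ) => ((1 + (s : ℝ)) ^ 2)⁻¹) μ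
  eq : ∃ c : ℝ, Tendsto f (𝓝[>] 0) (𝓝 c) ∧ ∀ x : ℝ, 0 < x →
    f x = c + a * x + b * x ^ 2
      + ∫ s : Set.Ioi (0 : ℝ), (x / (1 + (s : ℝ)) - x / (x + (s : ℝ))) ∂μ

/-- The linear operator `L_A R_B : X ↦ A X B` on the space of matrices. -/
def leftRight (A B : Matrix n n ℂ) : Matrix n n ℂ →ₗ[ℂ] Matrix n n ℂ :=
  LinearMap.mulLeft ℂ A ∘ₗ LinearMap.mulRight ℂ B

/-- Functional calculus `f(T)` of an operator `T` on the Hilbert space of matrices with the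
Hilbert-Schmidt inner product, computed in the orthonormal basis of the matrix units. -/
def superCfc (f : ℝ → ℝ) (T : Matrix n n ℂ →ₗ[ℂ] Matrix n n ℂ) :
    Matrix n n ℂ →ₗ[ℂ] Matrix n n ℂ :=
  Matrix.toLin (Matrix.stdBasis ℂ n n) (Matrix.stdBasis ℂ n n)
    (cfc f (LinearMap.toMatrix (Matrix.stdBasis ℂ n n) (Matrix.stdBasis ℂ n n) T))

/-- The standard `f`-divergence of positive definite matrices,
`⟨σ^{1/2}, f(L_ρ R_{σ⁻¹}) σ^{1/2}⟩_HS = Tr σ^{1/2} f(L_ρ R_{σ⁻¹})(σ^{1/2})` (a real number). -/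
def stdDivPos (f : ℝ → ℝ) (ρ σ : Matrix n n ℂ) : ℝ :=
  ((psdPow σ (1 / 2))ᴴ * superCfc f (leftRight ρ (psdPow σ (-1))) (psdPow σ (1 / 2))).trace.re

/-- The operator perspective `σ^{1/2} f(σ^{-1/2} ρ σ^{-1/2}) σ^{1/2}` of positive definite
matrices. -/
def perspective (f : ℝ → ℝ) (ρ σ : Matrix n n ℂ) : Matrix n n ℂ :=
  psdPow σ (1 / 2) * cfc f (psdPow σ (-1 / 2) * ρ * psdPow σ (-1 / 2)) * psdPow σ (1 / 2)

/-- The maximal `f`-divergence of positive definite matrices, the trace of the operator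
perspective (a real number). -/
def maxDivPos (f : ℝ → ℝ) (ρ σ : Matrix n n ℂ) : ℝ :=
  (perspective f ρ σ).trace.re

/-- `ε ↦ S_f(ρ + εI ‖ σ + εI)`, to be used for `ε > 0`. -/
def stdDivReg (f : ℝ → ℝ) (ρ σ : Matrix n n ℂ) (ε : ℝ) : EReal :=
  (stdDivPos f (ρ + ε • (1 : Matrix n n ℂ)) (σ + ε • (1 : Matrix n n ℂ)) : ℝ)

/-- `ε ↦ Ŝ_f(ρ + εI ‖ σ + εI)`, to be used for `ε > 0`. -/
def maxDivReg (f : ℝ → ℝ) (ρ σ : Matrix n n ℂ) (ε : ℝ) : EReal :=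
  (maxDivPos f (ρ + ε • (1 : Matrix n n ℂ)) (σ + ε • (1 : Matrix n n ℂ)) : ℝ)

/-- The standard `f`-divergence `S_f(ρ‖σ) = lim_{ε ↘ 0} S_f(ρ + εI ‖ σ + εI)` of positive
semidefinite matrices. -/
def stdDiv (f : ℝ → ℝ) (ρ σ : Matrix n n ℂ) : EReal :=
  limUnder (𝓝[>] (0 : ℝ)) (stdDivReg f ρ σ)

/-- The maximal `f`-divergence `Ŝ_f(ρ‖σ) = lim_{ε ↘ 0} Ŝ_f(ρ + εI ‖ σ + εI)` of positive
semidefinite matrices. -/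
def maxDiv (f : ℝ → ℝ) (ρ σ : Matrix n n ℂ) : EReal :=
  limUnder (𝓝[>] (0 : ℝ)) (maxDivReg f ρ σ)

end QuantumDivergence

end

/-!
The divergences of a qubit pair with noncommuting `ρ`, `γ` and `ρ⁰ ≤ γ⁰` (so that `γ > 0`) are
explicit. With eigenvalues `a₁ > a₂ ≥ 0` of `ρ`, `b₁ > b₂ > 0` of `γ` and overlap `t ∈ (0, 1)` of
the eigenprojections, `S_f` is a combination of the four values `f (aᵢ / bⱼ)` (`stdDivPos_eq`) and
`Ŝ_f` one of the values of `f` at the two eigenvalues `l₁ > l₂` of `γ^{-1/2} ρ γ^{-1/2}`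
(`maxDivPos_eq`). If `a₂ > 0`, the gap `Ŝ_f - S_f` is a positive combination of two quantities
`-[x₁, …, x₅](x f)`, where `[…]` is the divided difference at five points (`gap_eq`). If `a₂ = 0`,
it is a positive multiple of `-[x₁, x₂, x₃]((f - f(0⁺)) / x)`. So the strict inequality follows
once these divided differences are known to be negative for every non-polynomial operator convex
`f`.

No integral representation of `f` is needed for that. Jensen's inequality for operator convex
functions, applied to a diagonal matrix and to its compression to a hyperplane, says that
`0 ≤ [S](N² f)` for every set `S` of `2m + 1` positive points and every polynomial `N` of degree
below `m` (`divDiff_sq_mul_nonneg`): the points of `S` with even index are the eigenvalues of the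
matrix, those with odd index the eigenvalues of the compression. Letting one of the points tend to
`0` or to `∞` gives, for `g = x f` and six points as well as for `g = (f - f(0⁺)) / x` and four
points, the inequalities `0 ≤ [U] g` and `[U](x g) ≤ 0`. Since
`[S ∪ {w}](x g) = w [S ∪ {w}] g + [S] g`, an inequality `0 ≤ [S] g` forces `[S ∪ {w}] g = 0` for
every `w`, that is, `g` is a polynomial (`exists_eval_eq_of_divDiff_nonneg`).

The statement about the representing measure is a comparison of growth:
`IsRepresentation.eq_zero_of_isPolynomial`.
-/

noncomputable section

namespace QuantumDivergence

section

open Polynomial Lagrange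

/-! ### Divided differences -/

/-- The divided difference of `g` at the points of `S`, in its symmetric form
`∑ p ∈ S, g p / ∏ q ∈ S \ {p}, (p - q)`. -/
def divDiff (S : Finset ℝ) (g : ℝ → ℝ) : ℝ :=
  ∑ p ∈ S, g p / ∏ q ∈ S.erase p, (p - q)

lemma divDiff_congr {S : Finset ℝ} {g h : ℝ → ℝ} (H : ∀ p ∈ S, g p = h p) :
    divDiff S g = divDiff S h :=
  Finset.sum_congr rfl fun p hp => by rw [H p hp]

lemma divDiff_add (S : Finset ℝ) (g h : ℝ → ℝ) :
    divDiff S (fun x => g x + h x) = divDiff S g + divDiff S h := by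
  simp only [divDiff, add_div, Finset.sum_add_distrib]

lemma divDiff_sub (S : Finset ℝ) (g h : ℝ → ℝ) :
    divDiff S (fun x => g x - h x) = divDiff S g - divDiff S h := by
  simp only [divDiff, sub_div, Finset.sum_sub_distrib]

lemma divDiff_const_mul (S : Finset ℝ) (c : ℝ) (g : ℝ → ℝ) :
    divDiff S (fun x => c * g x) = c * divDiff S g := by
  simp only [divDiff, mul_div_assoc, Finset.mul_sum]

lemma divDiff_eval {S : Finset ℝ} {r : ℝ[X]} {m : ℕ} (hS : S.card = m + 1) (hr : r.degree < m) :
    divDiff S (fun x => r.eval x) = 0 := by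
  have h := coeff_eq_sum (s := S) (v := id) Function.injective_id.injOn (P := r)
    (hr.trans (by rw [hS]; exact_mod_cast Nat.lt_succ_self m))
  rw [hS, Nat.add_sub_cancel, coeff_eq_zero_of_degree_lt hr] at h
  exact h.symm

lemma divDiff_insert {S : Finset ℝ} {a : ℝ} (ha : a ∉ S) (g : ℝ → ℝ) :
    divDiff (insert a S) g = g a / ∏ q ∈ S, (a - q)
      + ∑ p ∈ S, g p / ((p - a) * ∏ q ∈ S.erase p, (p - q)) := by
  rw [divDiff, Finset.sum_insert ha, Finset.erase_insert ha]
  congr 1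
  refine Finset.sum_congr rfl fun p hp => ?_
  have hpa : a ≠ p := fun h => ha (h ▸ hp)
  rw [Finset.erase_insert_of_ne hpa,
    Finset.prod_insert fun h => ha (Finset.mem_of_mem_erase h)]

/-- A factor `x - a` removes the node `a`. -/
lemma divDiff_insert_sub_mul {S : Finset ℝ} {a : ℝ} (ha : a ∉ S) (g : ℝ → ℝ) :
    divDiff (insert a S) (fun x => (x - a) * g x) = divDiff S g := by
  rw [divDiff_insert ha, sub_self, zero_mul, zero_div, zero_add]
  refine Finset.sum_congr rfl fun p hp => ?_
  have hpa : p - a ≠ 0 := sub_ne_zero.2 fun h => ha (h ▸ hp)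
  rw [mul_div_mul_left _ _ hpa]

/-! ### Functional calculus on eigenvectors -/

section

variable {n m : Type*} [Fintype n] [DecidableEq n] [Fintype m] [DecidableEq m]

lemma cfc_mul_eq_mul_cfc (f : ℝ → ℝ) {A : Matrix n n ℂ} {D : Matrix m m ℂ} (hA : A.IsHermitian)
    (hD : D.IsHermitian) {Y : Matrix n m ℂ} (h : A * Y = Y * D) :
    cfc f A * Y = Y * cfc f D := by
  set s : Finset ℝ := A.finite_real_spectrum.toFinset ∪ D.finite_real_spectrum.toFinset with hs
  set r : ℝ[X] := interpolate s id f with hr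
  have hrs : ∀ x ∈ s, f x = r.eval x := fun x hx =>
    (eval_interpolate_at_node f (Function.injective_id.injOn) hx).symm
  have hA' : cfc f A = Polynomial.aeval A r := by
    rw [← cfc_polynomial r A hA.isSelfAdjoint]
    exact cfc_congr fun x hx => hrs x (by simp [hs, hx])
  have hD' : cfc f D = Polynomial.aeval D r := by
    rw [← cfc_polynomial r D hD.isSelfAdjoint]
    exact cfc_congr fun x hx => hrs x (by simp [hs, hx])
  have hpow : ∀ k : ℕ, A ^ k * Y = Y * D ^ k := by
    intro k
    induction k with
    | zero => simp
    | succ k ih => rw [pow_succ', Matrix.mul_assoc, ih, ← Matrix.mul_assoc, h, Matrix.mul_assoc,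
        ← pow_succ']
  rw [hA', hD']
  clear hA' hD' hrs hr
  clear_value r
  induction r using Polynomial.induction_on' with
  | add p q hp hq =>
    rw [map_add, map_add, Matrix.add_mul, Matrix.mul_add, hp, hq]
  | monomial k a =>
    rw [Polynomial.aeval_monomial, Polynomial.aeval_monomial, Algebra.algebraMap_eq_smul_one,
      Algebra.algebraMap_eq_smul_one, smul_mul_assoc, one_mul, smul_mul_assoc, one_mul,
      Matrix.smul_mul, hpow, Matrix.mul_smul]

lemma cfc_mul_of_mul_eq_smul (f : ℝ → ℝ) {A : Matrix n n ℂ} (hA : A.IsHermitian)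
    {Y : Matrix n m ℂ} {x : ℝ} (h : A * Y = x • Y) : cfc f A * Y = f x • Y := by
  have hD : (algebraMap ℝ (Matrix m m ℂ) x).IsHermitian := by
    rw [Algebra.algebraMap_eq_smul_one, Matrix.IsHermitian, Matrix.conjTranspose_smul]
    simp
  rw [cfc_mul_eq_mul_cfc f hA hD (Y := Y), cfc_algebraMap]
  · simp [Algebra.algebraMap_eq_smul_one]
  · simp [Algebra.algebraMap_eq_smul_one, h]

lemma cfc_mulVec_of_mulVec_eq_smul (f : ℝ → ℝ) {A : Matrix n n ℂ} (hA : A.IsHermitian)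
    {y : n → ℂ} {x : ℝ} (h : A *ᵥ y = x • y) : cfc f A *ᵥ y = f x • y := by
  have := cfc_mul_of_mul_eq_smul f hA (Y := Matrix.replicateCol Unit y) (x := x) (by
    rw [← Matrix.replicateCol_mulVec, h, Matrix.replicateCol_smul])
  rw [← Matrix.replicateCol_mulVec, ← Matrix.replicateCol_smul] at this
  exact Matrix.replicateCol_injective this

lemma cfc_diagonal (f : ℝ → ℝ) (d : n → ℝ) :
    cfc f (Matrix.diagonal fun i => (d i : ℂ)) = Matrix.diagonal fun i => (f (d i) : ℂ) := by
  have hH : (Matrix.diagonal fun i => (d i : ℂ)).IsHermitian :=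
    Matrix.isHermitian_diagonal_of_self_adjoint _ (by ext; simp)
  ext i j
  have h := cfc_mulVec_of_mulVec_eq_smul f hH (y := Pi.single j 1) (x := d j) (by
    ext k
    by_cases hk : k = j
    · subst hk; simp [Matrix.mulVec_diagonal]
    · simp [Matrix.mulVec_diagonal, hk])
  have h' := congrFun h i
  rw [Matrix.mulVec_single_one] at h'
  by_cases hij : i = j
  · subst hij; simpa using h'
  · simpa [hij] using h'

/-- The `E i` need not be projections, nor the `x i` distinct. -/
lemma cfc_eq_sum_smul {ι : Type*} [Fintype ι] (f : ℝ → ℝ) {A : Matrix n n ℂ}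
    (hA : A.IsHermitian) {E : ι → Matrix n n ℂ} {x : ι → ℝ} (h1 : ∑ i, E i = 1)
    (hE : ∀ i, A * E i = x i • E i) : cfc f A = ∑ i, f (x i) • E i := by
  rw [← Matrix.mul_one (cfc f A), ← h1, Finset.mul_sum]
  exact Finset.sum_congr rfl fun i _ => cfc_mul_of_mul_eq_smul f hA (hE i)

end

/-! ### Jensen's inequality for interlacing nodes -/

section Interlacing

variable {m : ℕ} {τ : Fin (m + 1) → ℝ} {y : Fin m → ℝ}

lemma strictMono_of_interlacing (h1 : ∀ k, τ k.castSucc < y k) (h2 : ∀ k, y k < τ k.succ) :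
    StrictMono τ :=
  Fin.strictMono_iff_lt_succ.2 fun k => (h1 k).trans (h2 k)

lemma strictMono_of_interlacing' (h1 : ∀ k, τ k.castSucc < y k) (h2 : ∀ k, y k < τ k.succ) :
    StrictMono y := fun k l hkl =>
  ((h2 k).trans_le ((strictMono_of_interlacing h1 h2).monotone
    (Fin.succ_le_castSucc_iff.2 hkl))).trans (h1 l)

lemma sub_div_sub_succAbove_pos (h1 : ∀ k, τ k.castSucc < y k) (h2 : ∀ k, y k < τ k.succ)
    (i : Fin (m + 1)) (k : Fin m) : 0 < (τ i - y k) * (τ i - τ (i.succAbove k))⁻¹ := by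
  have hτ := (strictMono_of_interlacing h1 h2).monotone
  rcases lt_or_ge k.castSucc i with hk | hk
  · rw [Fin.succAbove_of_castSucc_lt _ _ hk]
    have h3 : τ k.succ ≤ τ i := hτ (Fin.castSucc_lt_iff_succ_le.1 hk)
    have h4 := h1 k
    have h5 := h2 k
    exact mul_pos (by linarith) (inv_pos.2 (by linarith))
  · rw [Fin.succAbove_of_le_castSucc _ _ hk]
    have h3 : τ i ≤ τ k.castSucc := hτ hk
    have h4 := h1 k
    have h5 := h2 k
    exact mul_pos_of_neg_of_neg (by linarith) (inv_lt_zero.2 (by linarith))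

lemma interlacing_ne (h1 : ∀ k, τ k.castSucc < y k) (h2 : ∀ k, y k < τ k.succ)
    (i : Fin (m + 1)) (k : Fin m) : τ i ≠ y k := fun h => by
  have := sub_div_sub_succAbove_pos h1 h2 i k
  simp [h] at this

lemma prod_mul_nodalWeight_pos (h1 : ∀ k, τ k.castSucc < y k) (h2 : ∀ k, y k < τ k.succ)
    (i : Fin (m + 1)) : 0 < (∏ k, (τ i - y k)) * nodalWeight Finset.univ τ i := by
  have : nodalWeight Finset.univ τ i = ∏ k : Fin m, (τ i - τ (i.succAbove k))⁻¹ := by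
    rw [nodalWeight, show Finset.univ.erase i = Finset.univ.image i.succAbove by
      rw [Fin.image_succAbove_univ]; ext; simp,
      Finset.prod_image fun a _ b _ h => Fin.succAbove_right_injective h]
  rw [this, ← Finset.prod_mul_distrib]
  exact Finset.prod_pos fun k _ => sub_div_sub_succAbove_pos h1 h2 i k

end Interlacing

lemma sum_nodalWeight_mul_eval {m : ℕ} {τ : Fin (m + 1) → ℝ} (hτ : Function.Injective τ)
    {N : ℝ[X]} (hN : N.degree < (m + 1 : ℕ)) :
    ∑ i, nodalWeight Finset.univ τ i * N.eval (τ i) = N.coeff m := by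
  have h := coeff_eq_sum (s := Finset.univ) (v := τ) hτ.injOn (P := N) (by simpa using hN)
  simp only [Finset.card_univ, Fintype.card_fin, Nat.add_sub_cancel] at h
  rw [h]
  refine Finset.sum_congr rfl fun i _ => ?_
  rw [nodalWeight, Finset.prod_inv_distrib, div_eq_inv_mul]

/-- The partial fraction expansion of `N / ∏ k, (x - y k)`. -/
lemma eval_eq_prod_mul_sum {m : ℕ} {y : Fin m → ℝ} (hy : Function.Injective y)
    {N : ℝ[X]} (hN : N.degree < (m : ℕ)) {x : ℝ} (hx : ∀ k, x ≠ y k) :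
    N.eval x = (∏ k, (x - y k)) *
      ∑ k, nodalWeight Finset.univ y k * (x - y k)⁻¹ * N.eval (y k) := by
  have h := eval_interpolate_not_at_node (s := Finset.univ) (v := y)
    (fun k => N.eval (y k)) (x := x) (fun k _ => hx k)
  rwa [← eq_interpolate hy.injOn (by simpa using hN), eval_nodal] at h

section Reflection

variable {n : Type*} [Fintype n] [DecidableEq n]

lemma reflection_mulVec (v x : n → ℂ) :
    (1 - (2 : ℂ) • Matrix.vecMulVec v v) *ᵥ x = x - (2 * (v ⬝ᵥ x)) • v := by
  ext i
  simp [Matrix.sub_mulVec, Matrix.smul_mulVec, Matrix.vecMulVec_mulVec]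
  ring

lemma vecMul_reflection (v x : n → ℂ) :
    x ᵥ* (1 - (2 : ℂ) • Matrix.vecMulVec v v) = x - (2 * (v ⬝ᵥ x)) • v := by
  rw [← reflection_mulVec, ← Matrix.mulVec_transpose]
  simp [Matrix.transpose_vecMulVec]

lemma reflection_mul_self {v : n → ℂ} (hv : v ⬝ᵥ v = 1) :
    (1 - (2 : ℂ) • Matrix.vecMulVec v v) * (1 - (2 : ℂ) • Matrix.vecMulVec v v) = 1 := by
  have : Matrix.vecMulVec v v * Matrix.vecMulVec v v = Matrix.vecMulVec v v := by
    rw [Matrix.vecMulVec_mul_vecMulVec, hv]; simp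
  simp only [sub_mul, mul_sub, smul_mul_smul_comm, this, one_mul, mul_one]
  module

end Reflection

/-- Jensen's inequality `⟨c, f(C) c⟩ ≤ ⟨c, f(T) c⟩`, where `T` is the diagonal matrix with
eigenvalues `τ` and `C` is the compression of `T` to the orthogonal complement of the vector `v`
that gives `C` the eigenvalues `y`. -/
lemma OperatorConvex.sum_interlacing_nonneg {f : ℝ → ℝ} (hf : OperatorConvex f) {m : ℕ}
    {τ : Fin (m + 1) → ℝ} {y : Fin m → ℝ} (hpos : ∀ i, 0 < τ i)
    (h1 : ∀ k, τ k.castSucc < y k) (h2 : ∀ k, y k < τ k.succ)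
    {N : ℝ[X]} (hN : N.degree < m) :
    0 ≤ ∑ i, f (τ i) * N.eval (τ i) ^ 2 * nodalWeight Finset.univ τ i / ∏ k, (τ i - y k)
      + ∑ k, f (y k) * N.eval (y k) ^ 2 * nodalWeight Finset.univ y k / ∏ i, (y k - τ i) := by
  have hτi := (strictMono_of_interlacing h1 h2).injective
  have hyi := (strictMono_of_interlacing' h1 h2).injective
  have hne := interlacing_ne h1 h2
  set Y : Fin (m + 1) → ℝ := fun i => ∏ k, (τ i - y k) with hY
  set W := nodalWeight Finset.univ τ with hW
  set V := nodalWeight Finset.univ y with hV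
  have hYne : ∀ i, Y i ≠ 0 := fun i => Finset.prod_ne_zero_iff.2 fun k _ => sub_ne_zero.2 (hne i k)
  set v : Fin (m + 1) → ℝ := fun i => √(Y i * W i) with hv
  have hvsq : ∀ i, v i * v i = Y i * W i := fun i =>
    Real.mul_self_sqrt (prod_mul_nodalWeight_pos h1 h2 i).le
  set g : Fin m → Fin (m + 1) → ℝ := fun k i => v i / (τ i - y k) with hg
  set c : Fin (m + 1) → ℝ := fun i => v i * N.eval (τ i) / Y i with hc
  -- `v` is a unit vector since `∏ k, (x - y k)` is monic of degree `m`
  have hvv : ∑ i, v i * v i = 1 := by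
    have h := sum_nodalWeight_mul_eval hτi (N := nodal Finset.univ y)
      (by rw [degree_nodal]; simp; exact_mod_cast Nat.lt_succ_self m)
    have h' : (nodal Finset.univ y).coeff m = 1 := by
      have := (nodal_monic (s := Finset.univ) (v := y)).coeff_natDegree
      rwa [natDegree_nodal, Finset.card_univ, Fintype.card_fin] at this
    rw [h'] at h
    rw [← h]
    exact Finset.sum_congr rfl fun i _ => by rw [hvsq, eval_nodal]; ring
  have hvc : ∑ i, v i * c i = 0 := by
    have h := sum_nodalWeight_mul_eval hτi (N := N)
      (hN.trans (by exact_mod_cast Nat.lt_succ_self m))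
    rw [coeff_eq_zero_of_degree_lt hN] at h
    rw [← h]
    refine Finset.sum_congr rfl fun i _ => ?_
    have := hYne i
    rw [hc]
    field_simp
    rw [pow_two, hvsq]
    ring
  have hvg : ∀ k, ∑ i, v i * g k i = 0 := by
    intro k
    have hdeg : (nodal (Finset.univ.erase k) y).degree < (m : ℕ) := by
      rw [degree_nodal, Finset.card_erase_of_mem (Finset.mem_univ k)]
      simp only [Finset.card_univ, Fintype.card_fin]
      exact_mod_cast Nat.sub_lt k.pos one_pos
    have h := sum_nodalWeight_mul_eval hτi (N := nodal (Finset.univ.erase k) y)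
      (hdeg.trans (by exact_mod_cast Nat.lt_succ_self m))
    rw [coeff_eq_zero_of_degree_lt hdeg] at h
    rw [← h]
    refine Finset.sum_congr rfl fun i _ => ?_
    have := sub_ne_zero.2 (hne i k)
    rw [hg, eval_nodal]
    field_simp
    rw [pow_two, hvsq, hY]
    simp only
    rw [← Finset.mul_prod_erase _ _ (Finset.mem_univ k)]
    ring
  have hcg : ∀ k, ∑ i, c i * g k i = - (N.eval (y k) / ∏ i, (y k - τ i)) := by
    intro k
    have h := eval_eq_prod_mul_sum hτi (N := N) (hN.trans (by exact_mod_cast Nat.lt_succ_self m))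
      (x := y k) (fun i => (hne i k).symm)
    have hp : ∏ i, (y k - τ i) ≠ 0 :=
      Finset.prod_ne_zero_iff.2 fun i _ => sub_ne_zero.2 (hne i k).symm
    rw [h, mul_div_cancel_left₀ _ hp, ← Finset.sum_neg_distrib]
    refine Finset.sum_congr rfl fun i _ => ?_
    have e1 := hYne i
    have e2 := sub_ne_zero.2 (hne i k)
    have e3 : y k - τ i = -(τ i - y k) := by ring
    rw [hc, hg, e3, inv_neg]
    field_simp
    rw [pow_two, hvsq]
    ring
  have hcsum : ∀ i, c i = ∑ k, V k * N.eval (y k) * g k i := by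
    intro i
    rw [hc]
    simp only
    rw [eval_eq_prod_mul_sum hyi hN (hne i), mul_div_assoc, mul_div_cancel_left₀ _ (hYne i),
      Finset.mul_sum]
    exact Finset.sum_congr rfl fun k _ => by rw [hg]; simp only; ring
  set T : Matrix (Fin (m + 1)) (Fin (m + 1)) ℂ := Matrix.diagonal fun i => (τ i : ℂ) with hT
  set v' : Fin (m + 1) → ℂ := fun i => (v i : ℂ) with hv'
  set c' : Fin (m + 1) → ℂ := fun i => (c i : ℂ) with hc'
  set g' : Fin m → Fin (m + 1) → ℂ := fun k i => (g k i : ℂ) with hg'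
  have hvv' : v' ⬝ᵥ v' = 1 := by simp only [dotProduct, hv']; exact_mod_cast hvv
  have hvc' : v' ⬝ᵥ c' = 0 := by simp only [dotProduct, hv', hc']; exact_mod_cast hvc
  have hvg' : ∀ k, v' ⬝ᵥ g' k = 0 := fun k => by
    simp only [dotProduct, hv', hg']; exact_mod_cast hvg k
  have hcg' : ∀ k, c' ⬝ᵥ g' k = ((-(N.eval (y k) / ∏ i, (y k - τ i)) : ℝ) : ℂ) := fun k => by
    simp only [dotProduct, hc', hg']; exact_mod_cast hcg k
  have hcsum' : c' = ∑ k, (V k * N.eval (y k)) • g' k := by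
    ext i
    simp only [hc', hg', Finset.sum_apply, Pi.smul_apply, Complex.real_smul]
    exact_mod_cast hcsum i
  set R : Matrix (Fin (m + 1)) (Fin (m + 1)) ℂ := 1 - (2 : ℂ) • Matrix.vecMulVec v' v' with hR
  have hRR : R * R = 1 := reflection_mul_self hvv'
  have hRH : Rᴴ = R := by
    ext i j
    simp [hR, Matrix.vecMulVec_apply, hv', Matrix.one_apply, eq_comm, mul_comm]
  have hTpos : T.PosDef := Matrix.PosDef.diagonal fun i => by
    simpa using hpos i
  have hBpos : (R * T * R).PosDef := by
    have := hTpos.conjTranspose_mul_mul_same (B := R) (fun a b hab => by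
      have := congrArg (R *ᵥ ·) hab
      simpa [Matrix.mulVec_mulVec, hRR] using this)
    rwa [hRH] at this
  have hpsd := hf (m + 1) T (R * T * R) hTpos hBpos (1 / 2) (by norm_num) (by norm_num)
  set C := (1 / 2 : ℝ) • T + (1 - 1 / 2 : ℝ) • (R * T * R) with hC
  have hCH : C.IsHermitian := by
    rw [Matrix.IsHermitian, hC, Matrix.conjTranspose_add, Matrix.conjTranspose_smul,
      Matrix.conjTranspose_smul, hTpos.isHermitian.eq, hBpos.isHermitian.eq]
    simp
  have hCg : ∀ k, C *ᵥ g' k = y k • g' k := by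
    intro k
    have e1 : R *ᵥ g' k = g' k := by rw [hR, reflection_mulVec, hvg' k]; simp
    have e2 : T *ᵥ g' k = y k • g' k + v' := by
      ext i
      simp only [hT, Matrix.mulVec_diagonal, hg', hg, Pi.add_apply, Pi.smul_apply,
        Complex.real_smul, hv']
      have := sub_ne_zero.2 (hne i k)
      norm_cast
      field_simp
      ring
    have e3 : R *ᵥ v' = -v' := by rw [hR, reflection_mulVec, hvv']; module
    rw [hC, Matrix.add_mulVec, Matrix.smul_mulVec, Matrix.smul_mulVec, ← Matrix.mulVec_mulVec,
      ← Matrix.mulVec_mulVec, e1, e2, Matrix.mulVec_add, Matrix.mulVec_smul, e1, e3]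
    module
  have hfT : c' ⬝ᵥ cfc f T *ᵥ c' = ((∑ i, f (τ i) * c i ^ 2 : ℝ) : ℂ) := by
    rw [hT, cfc_diagonal]
    simp only [dotProduct, Matrix.mulVec_diagonal, hc']
    push_cast
    exact Finset.sum_congr rfl fun i _ => by ring
  have hfB : c' ⬝ᵥ cfc f (R * T * R) *ᵥ c' = ((∑ i, f (τ i) * c i ^ 2 : ℝ) : ℂ) := by
    have e1 : R *ᵥ c' = c' := by rw [hR, reflection_mulVec, hvc']; simp
    have e2 : c' ᵥ* R = c' := by rw [hR, vecMul_reflection, hvc']; simp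
    have e3 : cfc f (R * T * R) * R = R * cfc f T :=
      cfc_mul_eq_mul_cfc f hBpos.isHermitian hTpos.isHermitian
        (by rw [Matrix.mul_assoc, hRR, Matrix.mul_one])
    conv_lhs => rw [← e1]
    rw [Matrix.mulVec_mulVec, e3, e1, ← Matrix.mulVec_mulVec, Matrix.dotProduct_mulVec, e2, hfT]
  have hfC : c' ⬝ᵥ cfc f C *ᵥ c' = ((∑ k, V k * N.eval (y k) * f (y k) *
      (-(N.eval (y k) / ∏ i, (y k - τ i))) : ℝ) : ℂ) := by
    have : cfc f C *ᵥ c' = ∑ k, (V k * N.eval (y k) * f (y k)) • g' k := by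
      conv_lhs => rw [hcsum']
      rw [Matrix.mulVec_sum]
      refine Finset.sum_congr rfl fun k _ => ?_
      rw [Matrix.mulVec_smul, cfc_mulVec_of_mulVec_eq_smul f hCH (hCg k), smul_smul]
    rw [this, dotProduct_sum]
    push_cast
    refine Finset.sum_congr rfl fun k _ => ?_
    rw [dotProduct_smul, hcg' k, Complex.real_smul]
    push_cast
    ring
  have hfin := hpsd.dotProduct_mulVec_nonneg c'
  have hstar : star c' = c' := by ext i; simp [hc']
  rw [hstar, Matrix.sub_mulVec, Matrix.add_mulVec, Matrix.smul_mulVec, Matrix.smul_mulVec,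
    dotProduct_sub, dotProduct_add, dotProduct_smul, dotProduct_smul, hfT, hfB, hfC,
    Complex.real_smul, Complex.real_smul] at hfin
  have hfin' : 0 ≤ (1 / 2) * (∑ i, f (τ i) * c i ^ 2) + (1 - 1 / 2) * (∑ i, f (τ i) * c i ^ 2)
      - ∑ k, V k * N.eval (y k) * f (y k) * (-(N.eval (y k) / ∏ i, (y k - τ i))) := by
    exact_mod_cast hfin
  have e1 : ∑ i, f (τ i) * c i ^ 2 = ∑ i, f (τ i) * N.eval (τ i) ^ 2 * W i / Y i := by
    refine Finset.sum_congr rfl fun i _ => ?_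
    have := hYne i
    rw [hc]
    field_simp
    rw [pow_two (v i), hvsq]
    field_simp
  have e2 : ∑ k, V k * N.eval (y k) * f (y k) * (-(N.eval (y k) / ∏ i, (y k - τ i)))
      = - ∑ k, f (y k) * N.eval (y k) ^ 2 * V k / ∏ i, (y k - τ i) := by
    rw [← Finset.sum_neg_distrib]
    exact Finset.sum_congr rfl fun k _ => by ring
  rw [e1, e2] at hfin'
  linarith

lemma divDiff_union_image {m : ℕ} {τ : Fin (m + 1) → ℝ} {y : Fin m → ℝ}
    (hτ : Function.Injective τ) (hy : Function.Injective y) (hne : ∀ i k, τ i ≠ y k)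
    (g : ℝ → ℝ) :
    divDiff (Finset.univ.image τ ∪ Finset.univ.image y) g
      = ∑ i, g (τ i) * nodalWeight Finset.univ τ i / ∏ k, (τ i - y k)
      + ∑ k, g (y k) * nodalWeight Finset.univ y k / ∏ i, (y k - τ i) := by
  have hdisj : Disjoint (Finset.univ.image τ) (Finset.univ.image y) := by
    rw [Finset.disjoint_left]
    intro x hx hx'
    obtain ⟨i, -, rfl⟩ := Finset.mem_image.1 hx
    obtain ⟨k, -, h⟩ := Finset.mem_image.1 hx'
    exact hne i k h.symm
  rw [divDiff, Finset.sum_union hdisj, Finset.sum_image hτ.injOn, Finset.sum_image hy.injOn]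
  congr 1
  · refine Finset.sum_congr rfl fun i _ => ?_
    have h3 : τ i ∉ Finset.univ.image y := by simpa [eq_comm] using hne i
    rw [Finset.erase_union_distrib, Finset.erase_eq_of_notMem h3, ← Finset.image_erase hτ,
      Finset.prod_union (hdisj.mono_left (Finset.image_subset_image (Finset.erase_subset _ _))),
      Finset.prod_image hτ.injOn, Finset.prod_image hy.injOn, nodalWeight,
      Finset.prod_inv_distrib, div_mul_eq_div_div, div_eq_mul_inv (g (τ i))]
  · refine Finset.sum_congr rfl fun k _ => ?_
    have h3 : y k ∉ Finset.univ.image τ := by simpa using fun i => hne i k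
    rw [Finset.erase_union_distrib, Finset.erase_eq_of_notMem h3, ← Finset.image_erase hy,
      Finset.prod_union (hdisj.mono_right (Finset.image_subset_image (Finset.erase_subset _ _))),
      Finset.prod_image hτ.injOn, Finset.prod_image hy.injOn, nodalWeight,
      Finset.prod_inv_distrib, mul_comm, div_mul_eq_div_div, div_eq_mul_inv (g (y k))]

/-- The linear inequalities on the values of an operator convex function that Jensen's inequality
gives: the nodes are split alternately into eigenvalues of a matrix and of its compression. -/
theorem OperatorConvex.divDiff_sq_mul_nonneg {f : ℝ → ℝ} (hf : OperatorConvex f) {m : ℕ}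
    {S : Finset ℝ} (hS : S.card = 2 * m + 1) (hpos : ∀ x ∈ S, 0 < x) {N : ℝ[X]}
    (hN : N.degree < m) : 0 ≤ divDiff S fun x => N.eval x ^ 2 * f x := by
  set x := S.orderEmbOfFin hS with hx
  set τ : Fin (m + 1) → ℝ := fun i => x ⟨2 * i, by omega⟩ with hτ
  set y : Fin m → ℝ := fun k => x ⟨2 * k + 1, by omega⟩ with hy
  have h1 : ∀ k, τ k.castSucc < y k := fun k => x.strictMono (by simp [Fin.lt_def])
  have h2 : ∀ k, y k < τ k.succ := fun k => x.strictMono (by simp [Fin.lt_def]; omega)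
  have hSeq : S = Finset.univ.image τ ∪ Finset.univ.image y := by
    ext a
    constructor
    · intro ha
      rw [← Finset.image_orderEmbOfFin_univ S hS] at ha
      obtain ⟨j, -, rfl⟩ := Finset.mem_image.1 ha
      obtain ⟨q, hq⟩ := Nat.even_or_odd' j.1
      rcases hq with hq | hq
      · exact Finset.mem_union_left _ (Finset.mem_image.2 ⟨⟨q, by omega⟩, Finset.mem_univ _, by
          simp only [hτ, hx]; congr 1; exact Fin.ext hq.symm⟩)
      · exact Finset.mem_union_right _ (Finset.mem_image.2 ⟨⟨q, by omega⟩, Finset.mem_univ _, by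
          simp only [hy, hx]; congr 1; exact Fin.ext hq.symm⟩)
    · intro ha
      rcases Finset.mem_union.1 ha with ha | ha <;> obtain ⟨j, -, rfl⟩ := Finset.mem_image.1 ha
      · exact Finset.orderEmbOfFin_mem S hS _
      · exact Finset.orderEmbOfFin_mem S hS _
  have hmain := hf.sum_interlacing_nonneg (τ := τ) (y := y) (N := N)
    (fun i => hpos _ (Finset.orderEmbOfFin_mem S hS _)) h1 h2 hN
  rw [hSeq, divDiff_union_image (strictMono_of_interlacing h1 h2).injective
    (strictMono_of_interlacing' h1 h2).injective (interlacing_ne h1 h2)]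
  simpa only [mul_comm (N.eval _ ^ 2)] using hmain

/-! ### Strict inequalities for non-polynomial operator convex functions -/

lemma OperatorConvex.divDiff_sub_mul_nonneg {f : ℝ → ℝ} (hf : OperatorConvex f) {m : ℕ}
    {U : Finset ℝ} (hU : U.card = 2 * m) (hpos : ∀ x ∈ U, 0 < x) {N : ℝ[X]} {a : ℝ}
    (ha : 0 < a) (haU : a ∉ U) (hN : ((X - C a) * N).degree < (m : WithBot ℕ)) :
    0 ≤ divDiff U fun x => (x - a) * (N.eval x ^ 2 * f x) := by
  have h := hf.divDiff_sq_mul_nonneg (S := insert a U) (m := m)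
    (by rw [Finset.card_insert_of_notMem haU, hU]) (by
      intro x hx
      rcases Finset.mem_insert.1 hx with rfl | hx
      exacts [ha, hpos x hx]) hN
  rw [← divDiff_insert_sub_mul haU]
  convert h using 3
  simp
  ring

/-- The two conclusions are the limits `a → 0` and `a → ∞` of the hypothesis. -/
lemma divDiff_nonneg_of_forall_sub_mul {U : Finset ℝ} (hpos : ∀ x ∈ U, 0 < x) {g : ℝ → ℝ}
    (h : ∀ a, 0 < a → a ∉ U → 0 ≤ divDiff U fun x => (x - a) * g x) :
    0 ≤ divDiff U (fun x => x * g x) ∧ divDiff U g ≤ 0 := by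
  have hlin : ∀ a, divDiff U (fun x => (x - a) * g x)
      = divDiff U (fun x => x * g x) - a * divDiff U g := fun a => by
    rw [← divDiff_const_mul, ← divDiff_sub]
    exact divDiff_congr fun x _ => by ring
  constructor
  · have hev : ∀ᶠ a in 𝓝[>] (0 : ℝ), 0 ≤ divDiff U (fun x => x * g x) - a * divDiff U g := by
      have h0 : ∀ᶠ a in 𝓝 (0 : ℝ), a ∉ U :=
        U.finite_toSet.isClosed.isOpen_compl.eventually_mem fun h0 => lt_irrefl _ (hpos 0 h0)
      filter_upwards [self_mem_nhdsWithin, nhdsWithin_le_nhds h0] with a ha haU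
      rw [← hlin]
      exact h a ha haU
    have ht : Tendsto (fun a : ℝ => divDiff U (fun x => x * g x) - a * divDiff U g) (𝓝[>] 0)
        (𝓝 (divDiff U (fun x => x * g x) - 0 * divDiff U g)) :=
      (Continuous.tendsto (by fun_prop) 0).mono_left nhdsWithin_le_nhds
    simpa using ge_of_tendsto ht hev
  · by_contra! hD
    obtain ⟨M, hM⟩ := U.exists_le
    set q := divDiff U (fun x => x * g x) / divDiff U g with hq
    set a := max (max M 0) q + 1 with ha
    have h1 : M < a := by linarith [le_max_left M 0, le_max_left (max M 0) q]
    have h2 : 0 < a := by linarith [le_max_right M 0, le_max_left (max M 0) q]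
    have h3 : q < a := by linarith [le_max_right (max M 0) q]
    have h4 := h a h2 fun haU => absurd (hM a haU) (not_le.2 h1)
    rw [hlin] at h4
    rw [hq, div_lt_iff₀ hD] at h3
    linarith

/-- If the divided differences of `g` of one order are nonnegative and those of `x * g x` are
nonpositive, then those of `g` of the order before are nonpositive, and one of them can vanish
only for a polynomial. -/
lemma exists_eval_eq_of_divDiff_nonneg {g : ℝ → ℝ} {S : Finset ℝ} (hS : ∀ x ∈ S, 0 < x)
    (h1 : ∀ U : Finset ℝ, U.card = S.card + 1 → (∀ x ∈ U, 0 < x) → 0 ≤ divDiff U g)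
    (h2 : ∀ U : Finset ℝ, U.card = S.card + 1 → (∀ x ∈ U, 0 < x) →
      divDiff U (fun x => x * g x) ≤ 0)
    (h : 0 ≤ divDiff S g) : ∃ r : ℝ[X], ∀ x, 0 < x → g x = r.eval x := by
  set r : ℝ[X] := interpolate S id g with hr
  have hrS : ∀ x ∈ S, g x = r.eval x := fun x hx =>
    (eval_interpolate_at_node g Function.injective_id.injOn hx).symm
  refine ⟨r, fun w hw => ?_⟩
  by_cases hwS : w ∈ S
  · exact hrS w hwS
  have hcard : (insert w S).card = S.card + 1 := Finset.card_insert_of_notMem hwS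
  have hpos : ∀ x ∈ insert w S, 0 < x := by
    intro x hx
    rcases Finset.mem_insert.1 hx with rfl | hx
    exacts [hw, hS x hx]
  have h3 := h1 _ hcard hpos
  have h4 := h2 _ hcard hpos
  have h5 : divDiff (insert w S) (fun x => x * g x) = divDiff S g + w * divDiff (insert w S) g := by
    rw [← divDiff_insert_sub_mul hwS g, ← divDiff_const_mul, ← divDiff_add]
    exact divDiff_congr fun x _ => by ring
  have h6 : divDiff (insert w S) g = 0 := by
    by_contra h0
    have := mul_pos hw (lt_of_le_of_ne h3 (Ne.symm h0))
    linarith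
  have h7 : divDiff (insert w S) (fun x => g x - r.eval x) = 0 := by
    rw [divDiff_sub, h6, divDiff_eval hcard (degree_interpolate_lt _ Function.injective_id.injOn),
      sub_zero]
  rw [divDiff_insert hwS, Finset.sum_eq_zero fun p hp => by rw [hrS p hp, sub_self, zero_div],
    add_zero, div_eq_zero_iff] at h7
  rcases h7 with h7 | h7
  · linarith
  · obtain ⟨q, hq, hq0⟩ := Finset.prod_eq_zero_iff.1 h7
    exact absurd (sub_eq_zero.1 hq0 ▸ hq) hwS

lemma OperatorConvex.divDiff_id_mul_neg {f : ℝ → ℝ} (hf : OperatorConvex f) {c : ℝ}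
    (hc : Tendsto f (𝓝[>] 0) (𝓝 c)) (hnp : ¬ IsPolynomial f) {S : Finset ℝ} (hS : S.card = 5)
    (hpos : ∀ x ∈ S, 0 < x) : divDiff S (fun x => x * f x) < 0 := by
  by_contra! h
  obtain ⟨r, hr⟩ := exists_eval_eq_of_divDiff_nonneg hpos (fun U hU hUpos =>
    (divDiff_nonneg_of_forall_sub_mul hUpos fun a ha haU => by
      have := hf.divDiff_sub_mul_nonneg (m := 3) (by omega) hUpos (N := 1) ha haU (by
        rw [mul_one, degree_X_sub_C]; norm_num)
      simpa using this).1) (fun U hU hUpos => by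
    have := (divDiff_nonneg_of_forall_sub_mul (g := fun x => x ^ 2 * f x) hUpos fun a ha haU => by
      have := hf.divDiff_sub_mul_nonneg (m := 3) (by omega) hUpos (N := X) ha haU (by
        rw [degree_mul, degree_X_sub_C, degree_X]; norm_num)
      simpa using this).2
    simpa only [pow_two, mul_assoc] using this) h
  have h0 : r.eval 0 = 0 := by
    have t1 : Tendsto (fun x => x * f x) (𝓝[>] 0) (𝓝 (0 * c)) :=
      (tendsto_id.mono_left nhdsWithin_le_nhds).mul hc
    have t2 : Tendsto (fun x => r.eval x) (𝓝[>] 0) (𝓝 (r.eval 0)) :=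
      r.continuous.continuousAt.tendsto.mono_left nhdsWithin_le_nhds
    rw [zero_mul] at t1
    refine tendsto_nhds_unique t2 (t1.congr' ?_)
    filter_upwards [self_mem_nhdsWithin] with x hx using hr x hx
  obtain ⟨q, rfl⟩ : X ∣ r := X_dvd_iff.2 (by rwa [coeff_zero_eq_eval_zero])
  refine hnp ⟨q, fun x hx => ?_⟩
  have := hr x hx
  rw [eval_mul, eval_X] at this
  exact mul_left_cancel₀ hx.ne' this

/-- Strict concavity of the slope of `f` from `0`. -/
lemma OperatorConvex.divDiff_slope_neg {f : ℝ → ℝ} (hf : OperatorConvex f) {c : ℝ}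
    (hc : Tendsto f (𝓝[>] 0) (𝓝 c)) (hnp : ¬ IsPolynomial f) {S : Finset ℝ} (hS : S.card = 3)
    (hpos : ∀ x ∈ S, 0 < x) : divDiff S (fun x => (f x - c) / x) < 0 := by
  by_contra! h
  obtain ⟨r, hr⟩ := exists_eval_eq_of_divDiff_nonneg hpos (fun U hU hUpos => by
    have hU0 : (0 : ℝ) ∉ U := fun h0 => lt_irrefl _ (hUpos 0 h0)
    have hev : ∀ᶠ a in 𝓝[>] (0 : ℝ), 0 ≤ divDiff U fun x => (f x - f a) / (x - a) := by
      have h0 : ∀ᶠ a in 𝓝 (0 : ℝ), a ∉ U :=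
        U.finite_toSet.isClosed.isOpen_compl.eventually_mem hU0
      filter_upwards [self_mem_nhdsWithin, nhdsWithin_le_nhds h0] with a ha haU
      have hcard : (insert a U).card = 2 * 2 + 1 := by
        rw [Finset.card_insert_of_notMem haU, hU, hS]
      have h1 := hf.divDiff_sq_mul_nonneg (m := 2) hcard (by
        intro x hx
        rcases Finset.mem_insert.1 hx with rfl | hx
        exacts [ha, hUpos x hx]) (N := 1) (by rw [degree_one]; norm_num)
      have h2 : divDiff (insert a U) (fun _ => f a) = 0 := by
        have := divDiff_eval (r := C (f a)) hcard (degree_C_le.trans_lt (by norm_num))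
        simpa using this
      rw [← divDiff_insert_sub_mul haU]
      have h3 : divDiff (insert a U) (fun x => (x - a) * ((f x - f a) / (x - a)))
          = divDiff (insert a U) (fun x => f x - f a) := by
        refine divDiff_congr fun x _ => ?_
        by_cases hxa : x = a
        · simp [hxa]
        · exact mul_div_cancel₀ _ (sub_ne_zero.2 hxa)
      rw [h3, divDiff_sub, h2, sub_zero]
      simpa using h1
    refine ge_of_tendsto (tendsto_finsetSum _ fun p hp => Tendsto.div_const ?_ _) hev
    have hp0 : p - 0 ≠ 0 := by rw [sub_zero]; exact (hUpos p hp).ne'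
    have : Tendsto (fun a => (f p - f a) / (p - a)) (𝓝[>] 0) (𝓝 ((f p - c) / (p - 0))) :=
      ((tendsto_const_nhds (x := f p)).sub hc).div
      ((tendsto_const_nhds (x := p)).sub (tendsto_id.mono_left nhdsWithin_le_nhds)) hp0
    rwa [sub_zero] at this) (fun U hU hUpos => by
    have h1 := (divDiff_nonneg_of_forall_sub_mul (g := f) hUpos fun a ha haU => by
      have := hf.divDiff_sub_mul_nonneg (m := 2) (by omega) hUpos (N := 1) ha haU (by
        rw [mul_one, degree_X_sub_C]; norm_num)
      simpa using this).2
    have h2 : divDiff U (fun _ => c) = 0 := by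
      have := divDiff_eval (r := C c) (m := 3) (by omega : U.card = 3 + 1)
        (degree_C_le.trans_lt (by norm_num))
      simpa using this
    have h3 : divDiff U (fun x => x * ((f x - c) / x)) = divDiff U (fun x => f x - c) :=
      divDiff_congr fun x hx => mul_div_cancel₀ _ (hUpos x hx).ne'
    rw [h3, divDiff_sub, h2, sub_zero]
    exact h1) h
  refine hnp ⟨C c + X * r, fun x hx => ?_⟩
  have := hr x hx
  rw [div_eq_iff hx.ne'] at this
  simp only [eval_add, eval_C, eval_mul, eval_X]
  linarith

end

/-! ### Spectral decompositions -/

section Spectral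

variable {n : Type*} [Fintype n] [DecidableEq n]

/-- `A = ∑ i, a i • P i` with mutually orthogonal rank-one projections `P i` that sum to `1`. The
eigenvalues `a i` need not be distinct. -/
structure IsSpectralDecomp (A : Matrix n n ℂ) (a : n → ℝ) (P : n → Matrix n n ℂ) : Prop where
  isHermitian : ∀ i, (P i).IsHermitian
  mul_eq : ∀ i j, P i * P j = if i = j then P i else 0
  sum_eq : ∑ i, P i = 1
  eq_sum : A = ∑ i, a i • P i
  trace_eq : ∀ i, (P i).trace = 1

lemma exists_isSpectralDecomp {A : Matrix n n ℂ} (hA : A.IsHermitian) :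
    ∃ P, IsSpectralDecomp A hA.eigenvalues P := by
  set U : Matrix n n ℂ :=
    (hA.eigenvectorUnitary : Matrix n n ℂ) with hU
  have hUU : star U * U = 1 := Unitary.coe_star_mul_self hA.eigenvectorUnitary
  have hUU' : U * star U = 1 := Unitary.coe_mul_star_self hA.eigenvectorUnitary
  have hsum : ∑ i : n, Matrix.single i i (1 : ℂ) = 1 :=
    Matrix.sum_single_one
  refine ⟨fun i => U * Matrix.single i i 1 * star U, fun i => ?_, fun i j => ?_, ?_, ?_, fun i => ?_⟩
  · have : (Matrix.single i i (1 : ℂ)).IsHermitian := by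
      ext k l
      simp [Matrix.single_apply, and_comm]
    rw [Matrix.IsHermitian, Matrix.star_eq_conjTranspose, Matrix.conjTranspose_mul,
      Matrix.conjTranspose_mul, Matrix.conjTranspose_conjTranspose, this.eq, Matrix.mul_assoc]
  · calc U * Matrix.single i i 1 * star U * (U * Matrix.single j j 1 * star U)
        = U * (Matrix.single i i 1 * (star U * U) * Matrix.single j j 1) * star U := by
          simp only [Matrix.mul_assoc]
      _ = _ := by
          rw [hUU, Matrix.mul_one]
          split_ifs with h
          · subst h; simp
          · rw [Matrix.single_mul_single_of_ne _ _ _ _ h]; simp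
  · rw [← Finset.sum_mul, ← Finset.mul_sum, hsum, Matrix.mul_one, hUU']
  · conv_lhs => rw [hA.spectral_theorem, Unitary.conjStarAlgAut_apply,
      ← Matrix.sum_single_eq_diagonal]
    rw [Finset.mul_sum, Finset.sum_mul]
    refine Finset.sum_congr rfl fun i _ => ?_
    rw [show Matrix.single i i ((RCLike.ofReal ∘ hA.eigenvalues) i : ℂ)
        = hA.eigenvalues i • Matrix.single i i (1 : ℂ) by simp [Matrix.smul_single],
      Matrix.mul_smul, Matrix.smul_mul]
  · rw [Matrix.trace_mul_cycle, hUU, Matrix.one_mul, Matrix.trace_single_eq_same]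

variable {A B : Matrix n n ℂ} {a b : n → ℝ} {P Q : n → Matrix n n ℂ}

namespace IsSpectralDecomp

lemma isHermitian_sum (h : IsSpectralDecomp A a P) (c : n → ℝ) :
    (∑ i, c i • P i).IsHermitian := by
  rw [Matrix.IsHermitian, Matrix.conjTranspose_sum]
  exact Finset.sum_congr rfl fun i _ => by
    rw [Matrix.conjTranspose_smul, (h.isHermitian i).eq, star_trivial]

lemma sum_smul_mul (h : IsSpectralDecomp A a P) (c : n → ℝ) (j : n) :
    (∑ i, c i • P i) * P j = c j • P j := by
  simp [Finset.sum_mul, h.mul_eq]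

lemma mul_sum_smul (h : IsSpectralDecomp A a P) (c : n → ℝ) (j : n) :
    P j * (∑ i, c i • P i) = c j • P j := by
  simp [Finset.mul_sum, h.mul_eq]

lemma sum_smul_mul_sum_smul (h : IsSpectralDecomp A a P) (c d : n → ℝ) :
    (∑ i, c i • P i) * (∑ i, d i • P i) = ∑ i, (c i * d i) • P i := by
  rw [Finset.mul_sum]
  exact Finset.sum_congr rfl fun j _ => by
    rw [Matrix.mul_smul, h.sum_smul_mul, smul_smul, mul_comm]

lemma herm (h : IsSpectralDecomp A a P) : A.IsHermitian := h.eq_sum ▸ h.isHermitian_sum a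

lemma mul_proj (h : IsSpectralDecomp A a P) (j : n) : A * P j = a j • P j := by
  rw [h.eq_sum, h.sum_smul_mul]

lemma cfc_eq (h : IsSpectralDecomp A a P) (f : ℝ → ℝ) : cfc f A = ∑ i, f (a i) • P i :=
  cfc_eq_sum_smul f h.herm h.sum_eq h.mul_proj

lemma trace_sum (h : IsSpectralDecomp A a P) (c : n → ℝ) :
    (∑ i, c i • P i).trace = ((∑ i, c i : ℝ) : ℂ) := by
  simp [Matrix.trace_sum, Matrix.trace_smul, h.trace_eq]

lemma psdPow_eq (h : IsSpectralDecomp A a P) (ha : ∀ i, 0 < a i) (t : ℝ) :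
    psdPow A t = ∑ i, (a i ^ t) • P i := by
  rw [psdPow, h.cfc_eq]
  exact Finset.sum_congr rfl fun i _ => by rw [if_pos (ha i)]

lemma add_smul_one (h : IsSpectralDecomp A a P) (ε : ℝ) :
    IsSpectralDecomp (A + ε • (1 : Matrix n n ℂ)) (fun i => a i + ε) P where
  isHermitian := h.isHermitian
  mul_eq := h.mul_eq
  sum_eq := h.sum_eq
  eq_sum := by
    simp only [add_smul, Finset.sum_add_distrib]
    rw [← h.eq_sum, ← Finset.smul_sum, h.sum_eq]
  trace_eq := h.trace_eq

lemma comp_equiv (h : IsSpectralDecomp A a P) (e : n ≃ n) :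
    IsSpectralDecomp A (a ∘ e) (P ∘ e) where
  isHermitian i := h.isHermitian _
  mul_eq i j := by simp [h.mul_eq]
  sum_eq := by rw [← h.sum_eq]; exact Equiv.sum_comp e P
  eq_sum := by rw [h.eq_sum]; exact (Equiv.sum_comp e fun i => a i • P i).symm
  trace_eq i := h.trace_eq _

end IsSpectralDecomp

/-! ### The standard divergence in terms of eigenvalues -/

lemma stdBasis_repr_apply (X : Matrix n n ℂ) (p : n × n) :
    (Matrix.stdBasis ℂ n n).repr X p = X p.1 p.2 := by
  conv_lhs => rw [Matrix.matrix_eq_sum_single X]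
  simp only [map_sum, Finsupp.coe_finsetSum, Finset.sum_apply]
  have : ∀ i j, (Matrix.stdBasis ℂ n n).repr (Matrix.single i j (X i j)) p
      = if (i, j) = p then X i j else 0 := by
    intro i j
    rw [show Matrix.single i j (X i j) = X i j • Matrix.stdBasis ℂ n n (i, j) by
      rw [Matrix.stdBasis_eq_single, Matrix.smul_single, smul_eq_mul, mul_one], map_smul,
      Module.Basis.repr_self]
    simp [Finsupp.single_apply]
  simp only [this]
  rw [← Fintype.sum_prod_type' fun i j => if (i, j) = p then X i j else 0]
  simp

lemma isHermitian_toMatrix_leftRight (hA : A.IsHermitian) (hB : B.IsHermitian) :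
    (LinearMap.toMatrix (Matrix.stdBasis ℂ n n) (Matrix.stdBasis ℂ n n)
      (leftRight A B)).IsHermitian := by
  have h : ∀ p q : n × n, LinearMap.toMatrix (Matrix.stdBasis ℂ n n) (Matrix.stdBasis ℂ n n)
      (leftRight A B) p q = A p.1 q.1 * B q.2 p.2 := by
    rintro ⟨i, j⟩ ⟨k, l⟩
    rw [LinearMap.toMatrix_apply, stdBasis_repr_apply, Matrix.stdBasis_eq_single]
    simp [leftRight, Matrix.mul_apply, Matrix.single_apply, ite_and]
  ext p q
  rw [Matrix.conjTranspose_apply, h, h, star_mul', hA.apply, hB.apply]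

lemma superCfc_apply_of_eq_smul (f : ℝ → ℝ) (hA : A.IsHermitian) (hB : B.IsHermitian)
    {Y : Matrix n n ℂ} {x : ℝ} (h : A * Y * B = x • Y) :
    superCfc f (leftRight A B) Y = f x • Y := by
  have h' : leftRight A B Y = (x : ℂ) • Y := by
    simpa [leftRight, Matrix.mul_assoc] using h
  apply (Matrix.stdBasis ℂ n n).repr.injective
  ext p
  rw [superCfc, Matrix.repr_toLin, cfc_mulVec_of_mulVec_eq_smul f
    (isHermitian_toMatrix_leftRight hA hB) (x := x), stdBasis_repr_apply]
  · simp [stdBasis_repr_apply]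
  · rw [LinearMap.toMatrix_mulVec_repr, h', map_smul]
    ext p
    simp

/-- The double sum over the eigenvalues `a i / b j` of `L_A R_{B⁻¹}`, with eigenvectors
`P i * Q j`. -/
theorem stdDivPos_eq (f : ℝ → ℝ) (hA : IsSpectralDecomp A a P) (hB : IsSpectralDecomp B b Q)
    (hb : ∀ j, 0 < b j) :
    stdDivPos f A B = ∑ i, ∑ j, b j * f (a i / b j) * (P i * Q j).trace.re := by
  have hsqrt : psdPow B (1 / 2) = ∑ j, √(b j) • Q j := by
    simp only [hB.psdPow_eq hb, Real.sqrt_eq_rpow]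
  have hinv : psdPow B (-1) = ∑ j, (b j)⁻¹ • Q j := by
    simp only [hB.psdPow_eq hb, Real.rpow_neg_one]
  have hexp : psdPow B (1 / 2) = ∑ i, ∑ j, √(b j) • (P i * Q j) := by
    rw [hsqrt, ← Matrix.one_mul (∑ j, √(b j) • Q j), ← hA.sum_eq, Finset.sum_mul_sum]
    simp only [Matrix.mul_smul]
  have hbH : (psdPow B (-1)).IsHermitian := hinv ▸ hB.isHermitian_sum _
  have hcfc : superCfc f (leftRight A (psdPow B (-1))) (psdPow B (1 / 2))
      = ∑ i, ∑ j, (√(b j) * f (a i / b j)) • (P i * Q j) := by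
    rw [hexp]
    simp only [map_sum]
    refine Finset.sum_congr rfl fun i _ => Finset.sum_congr rfl fun j _ => ?_
    have h1 : A * (P i * Q j) * psdPow B (-1) = (a i / b j) • (P i * Q j) := by
      rw [← Matrix.mul_assoc, hA.mul_proj, Matrix.mul_assoc, hinv, hB.mul_sum_smul,
        Matrix.smul_mul, Matrix.mul_smul, smul_smul, div_eq_mul_inv]
    rw [← Complex.coe_smul (√(b j)), map_smul, superCfc_apply_of_eq_smul f hA.herm hbH h1,
      Complex.coe_smul, smul_smul]
  rw [stdDivPos, hcfc, hsqrt, (hB.isHermitian_sum _).eq, Finset.mul_sum]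
  simp only [Finset.mul_sum, Matrix.trace_sum, Complex.re_sum]
  refine Finset.sum_congr rfl fun i _ => Finset.sum_congr rfl fun j _ => ?_
  rw [Matrix.mul_smul, Matrix.trace_smul, Matrix.trace_mul_comm, Matrix.mul_assoc,
    hB.mul_sum_smul, Matrix.mul_smul, Matrix.trace_smul, smul_smul, Complex.smul_re, smul_eq_mul]
  have := Real.mul_self_sqrt (hb j).le
  linear_combination (f (a i / b j) * (P i * Q j).trace.re) * this

end Spectral

/-! ### Overlaps of spectral projections -/

section Overlap

variable {n : Type*} [Fintype n] [DecidableEq n]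
variable {A B : Matrix n n ℂ} {a b : n → ℝ} {P Q : n → Matrix n n ℂ}

lemma IsSpectralDecomp.trace_mul_eq (hA : IsSpectralDecomp A a P) (hB : IsSpectralDecomp B b Q)
    (i j : n) : (P i * Q j).trace = ((Q j * P i)ᴴ * (Q j * P i)).trace := by
  conv_rhs => rw [Matrix.conjTranspose_mul, (hA.isHermitian i).eq, (hB.isHermitian j).eq,
    Matrix.mul_assoc, ← Matrix.mul_assoc (Q j), hB.mul_eq, if_pos rfl, Matrix.trace_mul_comm,
    Matrix.mul_assoc, hA.mul_eq, if_pos rfl, Matrix.trace_mul_comm]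

lemma IsSpectralDecomp.trace_mul_nonneg (hA : IsSpectralDecomp A a P)
    (hB : IsSpectralDecomp B b Q) (i j : n) : 0 ≤ (P i * Q j).trace := by
  rw [hA.trace_mul_eq hB]
  exact (Matrix.posSemidef_conjTranspose_mul_self _).trace_nonneg

lemma IsSpectralDecomp.trace_mul_eq_re (hA : IsSpectralDecomp A a P)
    (hB : IsSpectralDecomp B b Q) (i j : n) :
    (P i * Q j).trace = ((P i * Q j).trace.re : ℂ) :=
  Complex.ext rfl (Complex.le_def.1 (hA.trace_mul_nonneg hB i j)).2.symm

lemma IsSpectralDecomp.commute_of_trace_mul_eq_zero (hA : IsSpectralDecomp A a P)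
    (hB : IsSpectralDecomp B b Q) {i j : n} (h : (P i * Q j).trace.re = 0) :
    Commute (P i) (Q j) := by
  have h1 : (P i * Q j).trace = 0 := by rw [hA.trace_mul_eq_re hB, h, Complex.ofReal_zero]
  rw [hA.trace_mul_eq hB, Matrix.trace_conjTranspose_mul_self_eq_zero_iff] at h1
  have h2 := congrArg Matrix.conjTranspose h1
  rw [Matrix.conjTranspose_mul, (hA.isHermitian i).eq, (hB.isHermitian j).eq,
    Matrix.conjTranspose_zero] at h2
  rw [Commute, SemiconjBy, h1, h2]

lemma IsSpectralDecomp.sum_trace_mul (hA : IsSpectralDecomp A a P)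
    (hB : IsSpectralDecomp B b Q) (i : n) : ∑ j, (P i * Q j).trace.re = 1 := by
  rw [← Complex.re_sum, ← Matrix.trace_sum, ← Finset.mul_sum, hB.sum_eq, Matrix.mul_one,
    hA.trace_eq, Complex.one_re]

lemma IsSpectralDecomp.sum_trace_mul' (hA : IsSpectralDecomp A a P)
    (hB : IsSpectralDecomp B b Q) (j : n) : ∑ i, (P i * Q j).trace.re = 1 := by
  rw [← Complex.re_sum, ← Matrix.trace_sum, ← Finset.sum_mul, hA.sum_eq, Matrix.one_mul,
    hB.trace_eq, Complex.one_re]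

end Overlap

/-! ### The maximal divergence of a qubit pair -/

section Qubit

variable {A B : Matrix (Fin 2) (Fin 2) ℂ} {a b : Fin 2 → ℝ} {P Q : Fin 2 → Matrix (Fin 2) (Fin 2) ℂ}

lemma IsSpectralDecomp.commute_of_commute (hA : IsSpectralDecomp A a P)
    (hB : IsSpectralDecomp B b Q) {i j : Fin 2} (h : Commute (P i) (Q j)) : Commute A B := by
  have hP : ∀ X, Commute (P i) X → Commute A X := by
    intro X hX
    have hall : ∀ k, Commute (P k) X := by
      have hs := hA.sum_eq
      rw [Fin.sum_univ_two] at hs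
      have e0 : P 0 = 1 - P 1 := eq_sub_of_add_eq hs
      have e1 : P 1 = 1 - P 0 := eq_sub_of_add_eq' hs
      intro k
      fin_cases i <;> fin_cases k
      · exact hX
      · exact e1 ▸ (Commute.one_left X).sub_left hX
      · exact e0 ▸ (Commute.one_left X).sub_left hX
      · exact hX
    rw [hA.eq_sum]
    exact Commute.sum_left _ _ _ fun k _ => (hall k).smul_left _
  have hQ : ∀ X, Commute X (Q j) → Commute X B := by
    intro X hX
    have hall : ∀ k, Commute X (Q k) := by
      have hs := hB.sum_eq
      rw [Fin.sum_univ_two] at hs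
      have e0 : Q 0 = 1 - Q 1 := eq_sub_of_add_eq hs
      have e1 : Q 1 = 1 - Q 0 := eq_sub_of_add_eq' hs
      intro k
      fin_cases j <;> fin_cases k
      · exact hX
      · exact e1 ▸ (Commute.one_right X).sub_right hX
      · exact e0 ▸ (Commute.one_right X).sub_right hX
      · exact hX
    rw [hB.eq_sum]
    exact Commute.sum_right _ _ _ fun k _ => (hall k).smul_right _
  exact hP B (hQ _ h)

lemma IsSpectralDecomp.overlap_two (hA : IsSpectralDecomp A a P) (hB : IsSpectralDecomp B b Q) :
    (P 0 * Q 1).trace.re = 1 - (P 0 * Q 0).trace.re ∧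
    (P 1 * Q 0).trace.re = 1 - (P 0 * Q 0).trace.re ∧
    (P 1 * Q 1).trace.re = (P 0 * Q 0).trace.re := by
  have h0 := hA.sum_trace_mul hB 0
  have h1 := hA.sum_trace_mul hB 1
  have h2 := hA.sum_trace_mul' hB 0
  rw [Fin.sum_univ_two] at h0 h1 h2
  refine ⟨?_, ?_, ?_⟩ <;> linarith

lemma IsSpectralDecomp.overlap_pos (hA : IsSpectralDecomp A a P) (hB : IsSpectralDecomp B b Q)
    (hAB : A * B ≠ B * A) (i j : Fin 2) : 0 < (P i * Q j).trace.re := by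
  refine lt_of_le_of_ne (Complex.le_def.1 (hA.trace_mul_nonneg hB i j)).1 fun h => hAB ?_
  exact hA.commute_of_commute hB (hA.commute_of_trace_mul_eq_zero hB h.symm)

lemma IsSpectralDecomp.det_sum_smul (hA : IsSpectralDecomp A a P) (c : Fin 2 → ℝ) :
    (∑ i, c i • P i).det = ((c 0 * c 1 : ℝ) : ℂ) := by
  have h1 := hA.trace_sum c
  have h2 := hA.trace_sum fun i => c i * c i
  rw [← hA.sum_smul_mul_sum_smul] at h2
  set X := ∑ i, c i • P i
  rw [Fin.sum_univ_two] at h1 h2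
  rw [Matrix.trace_fin_two, Matrix.mul_apply, Matrix.mul_apply, Fin.sum_univ_two,
    Fin.sum_univ_two] at h2
  rw [Matrix.trace_fin_two] at h1
  rw [Matrix.det_fin_two]
  push_cast at h1 h2 ⊢
  linear_combination (X 0 0 + X 1 1 + c 0 + c 1) / 2 * h1 - h2 / 2

lemma mul_self_fin_two (M : Matrix (Fin 2) (Fin 2) ℂ) :
    M * M = M.trace • M - M.det • (1 : Matrix (Fin 2) (Fin 2) ℂ) := by
  ext i j
  fin_cases i <;> fin_cases j <;>
    simp [Matrix.mul_apply, Fin.sum_univ_two, Matrix.trace_fin_two, Matrix.det_fin_two] <;> ring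

/-- The hypotheses say that `l₁` and `l₂` are the eigenvalues of `B^{-1/2} A B^{-1/2}`. -/
theorem maxDivPos_eq (f : ℝ → ℝ) (hA : IsSpectralDecomp A a P) (hB : IsSpectralDecomp B b Q)
    (hb : ∀ j, 0 < b j) {l₁ l₂ : ℝ} (hne : l₁ ≠ l₂)
    (hadd : l₁ + l₂ = ∑ i, ∑ j, a i / b j * (P i * Q j).trace.re)
    (hmul : l₁ * l₂ = a 0 * a 1 / (b 0 * b 1)) :
    maxDivPos f A B = ((a 0 + a 1) - l₂ * (b 0 + b 1)) / (l₁ - l₂) * f l₁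
      + (l₁ * (b 0 + b 1) - (a 0 + a 1)) / (l₁ - l₂) * f l₂ := by
  set G := psdPow B (-1 / 2) with hG
  set K := psdPow B (1 / 2) with hK
  have hGeq : G = ∑ j, (b j ^ (-1 / 2 : ℝ)) • Q j := hB.psdPow_eq hb _
  have hKeq : K = ∑ j, (b j ^ (1 / 2 : ℝ)) • Q j := hB.psdPow_eq hb _
  have hGG : G * G = ∑ j, (b j)⁻¹ • Q j := by
    rw [hGeq, hB.sum_smul_mul_sum_smul]
    refine Finset.sum_congr rfl fun j _ => ?_
    rw [← Real.rpow_add (hb j), ← Real.rpow_neg_one]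
    norm_num
  have hKK : K * K = B := by
    rw [hKeq, hB.sum_smul_mul_sum_smul]
    conv_rhs => rw [hB.eq_sum]
    refine Finset.sum_congr rfl fun j _ => ?_
    rw [← Real.rpow_add (hb j)]
    norm_num
  have hKG : K * G = 1 := by
    rw [hKeq, hGeq, hB.sum_smul_mul_sum_smul, ← hB.sum_eq]
    refine Finset.sum_congr rfl fun j _ => ?_
    rw [← Real.rpow_add (hb j)]
    norm_num
  have hGK : G * K = 1 := mul_eq_one_comm.1 hKG
  set M := G * A * G with hM
  have hMH : M.IsHermitian := by
    have hGH : G.IsHermitian := hGeq ▸ hB.isHermitian_sum _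
    rw [Matrix.IsHermitian, hM, Matrix.conjTranspose_mul, Matrix.conjTranspose_mul, hGH.eq,
      hA.herm.eq, Matrix.mul_assoc]
  have htr : M.trace = ((l₁ + l₂ : ℝ) : ℂ) := by
    rw [hM, Matrix.mul_assoc, Matrix.trace_mul_comm, Matrix.mul_assoc, hGG, hadd]
    conv_lhs => rw [hA.eq_sum]
    rw [Finset.sum_mul_sum]
    simp only [Matrix.trace_sum, Matrix.smul_mul, Matrix.mul_smul, Matrix.trace_smul]
    push_cast
    refine Finset.sum_congr rfl fun i _ => Finset.sum_congr rfl fun j _ => ?_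
    rw [← hA.trace_mul_eq_re hB]
    simp only [Complex.real_smul]
    push_cast
    ring
  have hdet : M.det = ((l₁ * l₂ : ℝ) : ℂ) := by
    have h1 : A.det = ((a 0 * a 1 : ℝ) : ℂ) := by
      conv_lhs => rw [hA.eq_sum]
      exact hA.det_sum_smul a
    have h2 : G.det * G.det = (((b 0)⁻¹ * (b 1)⁻¹ : ℝ) : ℂ) := by
      rw [← Matrix.det_mul, hGG]
      exact hB.det_sum_smul fun j => (b j)⁻¹
    rw [hM, Matrix.det_mul, Matrix.det_mul, h1, hmul, mul_right_comm, h2]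
    push_cast
    field_simp
  have hsub : l₁ - l₂ ≠ 0 := sub_ne_zero.2 hne
  have hMM := mul_self_fin_two M
  rw [htr, hdet, Complex.coe_smul, Complex.coe_smul] at hMM
  set E : Fin 2 → Matrix (Fin 2) (Fin 2) ℂ :=
    ![(l₁ - l₂)⁻¹ • (M - l₂ • 1), (l₁ - l₂)⁻¹ • (l₁ • 1 - M)] with hE
  have hE1 : ∑ i, E i = 1 := by
    rw [Fin.sum_univ_two]
    simp only [hE, Matrix.cons_val_zero, Matrix.cons_val_one]
    rw [← smul_add, show M - l₂ • (1 : Matrix (Fin 2) (Fin 2) ℂ) + (l₁ • 1 - M)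
      = (l₁ - l₂) • 1 by module, smul_smul, inv_mul_cancel₀ hsub, one_smul]
  have hEM : ∀ i, M * E i = ![l₁, l₂] i • E i := by
    refine Fin.forall_fin_two.2 ⟨?_, ?_⟩
    · simp only [hE, Matrix.cons_val_zero, Matrix.mul_smul, Matrix.mul_sub, hMM, Matrix.mul_one]
      module
    · simp only [hE, Matrix.cons_val_one, Matrix.cons_val_zero, Matrix.mul_smul, Matrix.mul_sub,
        hMM, Matrix.mul_one]
      module
  have hcfc := cfc_eq_sum_smul f hMH hE1 hEM
  have hKMK : K * M * K = A := by
    rw [hM, ← Matrix.mul_assoc, ← Matrix.mul_assoc, hKG, Matrix.one_mul, Matrix.mul_assoc, hGK,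
      Matrix.mul_one]
  have htA : A.trace = ((a 0 + a 1 : ℝ) : ℂ) := by
    conv_lhs => rw [hA.eq_sum]
    rw [hA.trace_sum, Fin.sum_univ_two]
  have htB : B.trace = ((b 0 + b 1 : ℝ) : ℂ) := by
    conv_lhs => rw [hB.eq_sum]
    rw [hB.trace_sum, Fin.sum_univ_two]
  rw [maxDivPos, perspective, ← hG, ← hK, ← hM, hcfc, Fin.sum_univ_two]
  simp only [hE, Matrix.cons_val_zero, Matrix.cons_val_one, Matrix.mul_add, Matrix.add_mul,
    Matrix.mul_smul, Matrix.smul_mul, Matrix.mul_sub, Matrix.sub_mul, Matrix.mul_one, hKMK, hKK,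
    Matrix.trace_add, Matrix.trace_smul, Matrix.trace_sub, htA, htB, Complex.add_re,
    Complex.smul_re, Complex.sub_re, Complex.ofReal_re, smul_eq_mul]
  field_simp

end Qubit

/-! ### The gap between the divergences of a qubit pair -/

section Gap

variable {a₁ a₂ b₁ b₂ t l₁ l₂ : ℝ}

/-- The trace of `B^{-1/2} A B^{-1/2}` for qubit operators `A`, `B` with eigenvalues `a₁, a₂` and
`b₁, b₂`, where `t` is the overlap of the eigenprojections for `a₁` and `b₁`. -/
def relTrace (a₁ a₂ b₁ b₂ t : ℝ) : ℝ :=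
  a₁ / b₁ * t + a₁ / b₂ * (1 - t) + (a₂ / b₁ * (1 - t) + a₂ / b₂ * t)

/-- The determinant of `B^{-1/2} A B^{-1/2}`. -/
def relDet (a₁ a₂ b₁ b₂ : ℝ) : ℝ := a₁ * a₂ / (b₁ * b₂)

lemma charPoly_mul_eq (hb₁ : b₁ ≠ 0) (hb₂ : b₂ ≠ 0) (x : ℝ) :
    (x ^ 2 - relTrace a₁ a₂ b₁ b₂ t * x + relDet a₁ a₂ b₁ b₂) * (b₁ * b₂)
      = t * ((a₁ - x * b₁) * (a₂ - x * b₂)) + (1 - t) * ((a₁ - x * b₂) * (a₂ - x * b₁)) := by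
  rw [relTrace, relDet]
  field_simp
  ring

lemma charPoly_neg (ht1 : t < 1) (ha₂ : 0 ≤ a₂) (ha : a₂ < a₁) (hb₂ : 0 < b₂) (hb : b₂ < b₁) :
    (a₁ / b₁) ^ 2 - relTrace a₁ a₂ b₁ b₂ t * (a₁ / b₁) + relDet a₁ a₂ b₁ b₂ < 0 := by
  have hb₁ : 0 < b₁ := hb₂.trans hb
  have ha₁ : 0 < a₁ := ha₂.trans_lt ha
  have h := charPoly_mul_eq (a₁ := a₁) (a₂ := a₂) (t := t) hb₁.ne' hb₂.ne' (a₁ / b₁)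
  rw [show t * ((a₁ - a₁ / b₁ * b₁) * (a₂ - a₁ / b₁ * b₂))
      + (1 - t) * ((a₁ - a₁ / b₁ * b₂) * (a₂ - a₁ / b₁ * b₁))
      = -((1 - t) * (a₁ * (b₁ - b₂) / b₁ * (a₁ - a₂))) by field_simp; ring] at h
  have h1 : 0 < (1 - t) * (a₁ * (b₁ - b₂) / b₁ * (a₁ - a₂)) := by
    have := sub_pos.2 ht1
    have := sub_pos.2 ha
    have := sub_pos.2 hb
    positivity
  by_contra! hc
  have := mul_nonneg hc (mul_pos hb₁ hb₂).le
  linarith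

lemma discr_pos (ht1 : t < 1) (ha₂ : 0 ≤ a₂) (ha : a₂ < a₁) (hb₂ : 0 < b₂) (hb : b₂ < b₁) :
    0 < relTrace a₁ a₂ b₁ b₂ t ^ 2 - 4 * relDet a₁ a₂ b₁ b₂ := by
  have := charPoly_neg ht1 ha₂ ha hb₂ hb
  nlinarith [sq_nonneg (2 * (a₁ / b₁) - relTrace a₁ a₂ b₁ b₂ t)]

/-- The real data of a noncommuting qubit pair: eigenvalues `a₁ > a₂ ≥ 0` of `A` and
`b₁ > b₂ > 0` of `B`, the overlap `t`, and the eigenvalues `l₁ > l₂` of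
`B^{-1/2} A B^{-1/2}`. -/
structure IsQubitData (a₁ a₂ b₁ b₂ t l₁ l₂ : ℝ) : Prop where
  t_pos : 0 < t
  t_lt : t < 1
  nonneg : 0 ≤ a₂
  a_lt : a₂ < a₁
  pos : 0 < b₂
  b_lt : b₂ < b₁
  l_lt : l₂ < l₁
  add : l₁ + l₂ = relTrace a₁ a₂ b₁ b₂ t
  mul : l₁ * l₂ = relDet a₁ a₂ b₁ b₂

lemma between_of_mul_neg {x : ℝ} (hl : l₂ < l₁) (h : (x - l₁) * (x - l₂) < 0) :
    l₂ < x ∧ x < l₁ := by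
  rcases mul_neg_iff.1 h with h | h <;> constructor <;> linarith

/-- The two coefficients are determined by the values of the functional at `1` and at `x`. -/
lemma coeff_eq_of_moments {u v α β : ℝ} (hl : l₁ ≠ l₂) (h0 : u + v = β)
    (h1 : u * l₁ + v * l₂ = α) :
    u = (α - l₂ * β) / (l₁ - l₂) ∧ v = (l₁ * β - α) / (l₁ - l₂) := by
  have := sub_ne_zero.2 hl
  constructor
  · rw [eq_div_iff this, ← h0, ← h1]; ring
  · rw [eq_div_iff this, ← h0, ← h1]; ring

lemma divDiff_three {x₁ x₂ x₃ : ℝ} (h₁ : x₁ < x₂) (h₂ : x₂ < x₃) (g : ℝ → ℝ) :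
    divDiff {x₁, x₂, x₃} g = g x₁ / ((x₁ - x₂) * (x₁ - x₃)) + g x₂ / ((x₂ - x₁) * (x₂ - x₃))
      + g x₃ / ((x₃ - x₁) * (x₃ - x₂)) := by
  have e1 : ({x₁, x₂, x₃} : Finset ℝ).erase x₁ = {x₂, x₃} := by grind
  have e2 : ({x₁, x₂, x₃} : Finset ℝ).erase x₂ = {x₁, x₃} := by grind
  have e3 : ({x₁, x₂, x₃} : Finset ℝ).erase x₃ = {x₁, x₂} := by grind
  rw [divDiff, Finset.sum_insert (by grind), Finset.sum_insert (by grind), Finset.sum_singleton,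
    e1, e2, e3, Finset.prod_pair (by grind), Finset.prod_pair (by grind),
    Finset.prod_pair (by grind), add_assoc]

lemma card_five {x₁ x₂ x₃ x₄ x₅ : ℝ} (h₁ : x₁ < x₂) (h₂ : x₂ < x₃) (h₃ : x₃ < x₄)
    (h₄ : x₄ < x₅) : ({x₁, x₂, x₃, x₄, x₅} : Finset ℝ).card = 5 := by
  rw [Finset.card_insert_of_notMem (by grind), Finset.card_insert_of_notMem (by grind),
    Finset.card_insert_of_notMem (by grind), Finset.card_pair (by grind)]

lemma divDiff_five {x₁ x₂ x₃ x₄ x₅ : ℝ} (h₁ : x₁ < x₂) (h₂ : x₂ < x₃) (h₃ : x₃ < x₄)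
    (h₄ : x₄ < x₅) (g : ℝ → ℝ) :
    divDiff {x₁, x₂, x₃, x₄, x₅} g
      = g x₁ / ((x₁ - x₄) * (x₁ - x₂) * (x₁ - x₃) * (x₁ - x₅))
      + g x₂ / ((x₂ - x₁) * (x₂ - x₃) * (x₂ - x₄) * (x₂ - x₅))
      + g x₃ / ((x₃ - x₄) * (x₃ - x₂) * (x₃ - x₁) * (x₃ - x₅))
      + g x₄ / ((x₄ - x₁) * (x₄ - x₂) * (x₄ - x₃) * (x₄ - x₅))
      + g x₅ / ((x₅ - x₄) * (x₅ - x₂) * (x₅ - x₁) * (x₅ - x₃)) := by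
  have e1 : ({x₁, x₂, x₃, x₄, x₅} : Finset ℝ).erase x₁ = {x₂, x₃, x₄, x₅} := by grind
  have e2 : ({x₁, x₂, x₃, x₄, x₅} : Finset ℝ).erase x₂ = {x₁, x₃, x₄, x₅} := by grind
  have e3 : ({x₁, x₂, x₃, x₄, x₅} : Finset ℝ).erase x₃ = {x₁, x₂, x₄, x₅} := by grind
  have e4 : ({x₁, x₂, x₃, x₄, x₅} : Finset ℝ).erase x₄ = {x₁, x₂, x₃, x₅} := by grind
  have e5 : ({x₁, x₂, x₃, x₄, x₅} : Finset ℝ).erase x₅ = {x₁, x₂, x₃, x₄} := by grind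
  have hp : ∀ {y₁ y₂ y₃ y₄ : ℝ} (k : ℝ → ℝ), y₁ < y₂ → y₂ < y₃ → y₃ < y₄ →
      ∏ q ∈ ({y₁, y₂, y₃, y₄} : Finset ℝ), k q = k y₁ * (k y₂ * (k y₃ * k y₄)) := by
    intro y₁ y₂ y₃ y₄ k _ _ _
    rw [Finset.prod_insert (by grind), Finset.prod_insert (by grind),
      Finset.prod_pair (by grind)]
  rw [divDiff, Finset.sum_insert (by grind), Finset.sum_insert (by grind),
    Finset.sum_insert (by grind), Finset.sum_insert (by grind), Finset.sum_singleton,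
    e1, e2, e3, e4, e5, hp _ h₂ h₃ h₄, hp _ (h₁.trans h₂) h₃ h₄, hp _ h₁ (h₂.trans h₃) h₄,
    hp _ h₁ h₂ (h₃.trans h₄), hp _ h₁ h₂ h₃]
  rw [show (x₁ - x₂) * ((x₁ - x₃) * ((x₁ - x₄) * (x₁ - x₅)))
      = (x₁ - x₄) * (x₁ - x₂) * (x₁ - x₃) * (x₁ - x₅) by ring,
    show (x₂ - x₁) * ((x₂ - x₃) * ((x₂ - x₄) * (x₂ - x₅)))
      = (x₂ - x₁) * (x₂ - x₃) * (x₂ - x₄) * (x₂ - x₅) by ring,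
    show (x₃ - x₁) * ((x₃ - x₂) * ((x₃ - x₄) * (x₃ - x₅)))
      = (x₃ - x₄) * (x₃ - x₂) * (x₃ - x₁) * (x₃ - x₅) by ring,
    show (x₄ - x₁) * ((x₄ - x₂) * ((x₄ - x₃) * (x₄ - x₅)))
      = (x₄ - x₁) * (x₄ - x₂) * (x₄ - x₃) * (x₄ - x₅) by ring,
    show (x₅ - x₁) * ((x₅ - x₂) * ((x₅ - x₃) * (x₅ - x₄)))
      = (x₅ - x₄) * (x₅ - x₂) * (x₅ - x₁) * (x₅ - x₃) by ring]
  ring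

namespace IsQubitData

lemma b₁_pos (h : IsQubitData a₁ a₂ b₁ b₂ t l₁ l₂) : 0 < b₁ := h.pos.trans h.b_lt

lemma a₁_pos (h : IsQubitData a₁ a₂ b₁ b₂ t l₁ l₂) : 0 < a₁ := h.nonneg.trans_lt h.a_lt

lemma sub_mul_sub_mul_eq (h : IsQubitData a₁ a₂ b₁ b₂ t l₁ l₂) (x : ℝ) :
    (x - l₁) * (x - l₂) * (b₁ * b₂)
      = t * ((a₁ - x * b₁) * (a₂ - x * b₂)) + (1 - t) * ((a₁ - x * b₂) * (a₂ - x * b₁)) := by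
  rw [← charPoly_mul_eq h.b₁_pos.ne' h.pos.ne', ← h.add, ← h.mul]
  ring

lemma sub_mul_sub_11 (h : IsQubitData a₁ a₂ b₁ b₂ t l₁ l₂) :
    (a₁ / b₁ - l₁) * (a₁ / b₁ - l₂)
      = -((1 - t) * (a₁ * (b₁ - b₂) * (a₁ - a₂)) / (b₁ ^ 2 * b₂)) := by
  have h1 := h.sub_mul_sub_mul_eq (a₁ / b₁)
  have := h.b₁_pos.ne'
  have := h.pos.ne'
  rw [← eq_div_iff (by positivity)] at h1
  rw [h1]
  field_simp
  ring

lemma sub_mul_sub_22 (h : IsQubitData a₁ a₂ b₁ b₂ t l₁ l₂) :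
    (a₂ / b₂ - l₁) * (a₂ / b₂ - l₂)
      = -((1 - t) * (a₂ * (b₁ - b₂) * (a₁ - a₂)) / (b₁ * b₂ ^ 2)) := by
  have h1 := h.sub_mul_sub_mul_eq (a₂ / b₂)
  have := h.b₁_pos.ne'
  have := h.pos.ne'
  rw [← eq_div_iff (by positivity)] at h1
  rw [h1]
  field_simp
  ring

lemma sub_mul_sub_12 (h : IsQubitData a₁ a₂ b₁ b₂ t l₁ l₂) :
    (a₁ / b₂ - l₁) * (a₁ / b₂ - l₂)
      = t * (a₁ * (b₁ - b₂) * (a₁ - a₂)) / (b₁ * b₂ ^ 2) := by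
  have h1 := h.sub_mul_sub_mul_eq (a₁ / b₂)
  have := h.b₁_pos.ne'
  have := h.pos.ne'
  rw [← eq_div_iff (by positivity)] at h1
  rw [h1]
  field_simp
  ring

lemma sub_mul_sub_21 (h : IsQubitData a₁ a₂ b₁ b₂ t l₁ l₂) :
    (a₂ / b₁ - l₁) * (a₂ / b₁ - l₂)
      = t * (a₂ * (b₁ - b₂) * (a₁ - a₂)) / (b₁ ^ 2 * b₂) := by
  have h1 := h.sub_mul_sub_mul_eq (a₂ / b₁)
  have := h.b₁_pos.ne'
  have := h.pos.ne'
  rw [← eq_div_iff (by positivity)] at h1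
  rw [h1]
  field_simp
  ring

lemma between_11 (h : IsQubitData a₁ a₂ b₁ b₂ t l₁ l₂) : l₂ < a₁ / b₁ ∧ a₁ / b₁ < l₁ := by
  refine between_of_mul_neg h.l_lt ?_
  rw [h.sub_mul_sub_11, neg_lt_zero]
  have := h.b₁_pos
  have := h.a₁_pos
  have := h.pos
  have := sub_pos.2 h.t_lt
  have := sub_pos.2 h.a_lt
  have := sub_pos.2 h.b_lt
  positivity

lemma between_22 (h : IsQubitData a₁ a₂ b₁ b₂ t l₁ l₂) (ha₂ : 0 < a₂) :
    l₂ < a₂ / b₂ ∧ a₂ / b₂ < l₁ := by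
  refine between_of_mul_neg h.l_lt ?_
  rw [h.sub_mul_sub_22, neg_lt_zero]
  have := h.b₁_pos
  have := h.pos
  have := sub_pos.2 h.t_lt
  have := sub_pos.2 h.a_lt
  have := sub_pos.2 h.b_lt
  positivity

lemma lt_12 (h : IsQubitData a₁ a₂ b₁ b₂ t l₁ l₂) : l₁ < a₁ / b₂ := by
  have h1 : 0 < (a₁ / b₂ - l₁) * (a₁ / b₂ - l₂) := by
    rw [h.sub_mul_sub_12]
    have := h.b₁_pos
    have := h.a₁_pos
    have := h.pos
    have := h.t_pos
    have := sub_pos.2 h.a_lt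
    have := sub_pos.2 h.b_lt
    positivity
  have h2 : l₂ < a₁ / b₂ :=
    h.between_11.1.trans (div_lt_div_of_pos_left h.a₁_pos h.pos h.b_lt)
  exact sub_pos.1 (pos_of_mul_pos_left h1 (sub_pos.2 h2).le)

lemma lt_21 (h : IsQubitData a₁ a₂ b₁ b₂ t l₁ l₂) (ha₂ : 0 < a₂) : a₂ / b₁ < l₂ := by
  have h1 : 0 < (l₁ - a₂ / b₁) * (l₂ - a₂ / b₁) := by
    have e : (l₁ - a₂ / b₁) * (l₂ - a₂ / b₁) = (a₂ / b₁ - l₁) * (a₂ / b₁ - l₂) := by ring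
    rw [e, h.sub_mul_sub_21]
    have := h.b₁_pos
    have := h.pos
    have := h.t_pos
    have := sub_pos.2 h.a_lt
    have := sub_pos.2 h.b_lt
    positivity
  have h2 : a₂ / b₁ < l₁ :=
    (div_lt_div_of_pos_left ha₂ h.pos h.b_lt).trans (h.between_22 ha₂).2
  exact sub_pos.1 (pos_of_mul_pos_right h1 (sub_pos.2 h2).le)

lemma l₁_pos (h : IsQubitData a₁ a₂ b₁ b₂ t l₁ l₂) : 0 < l₁ :=
  (div_pos h.a₁_pos h.b₁_pos).trans h.between_11.2

lemma l₂_nonneg (h : IsQubitData a₁ a₂ b₁ b₂ t l₁ l₂) : 0 ≤ l₂ := by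
  have h1 : 0 ≤ l₁ * l₂ := by
    rw [h.mul, relDet]
    have := h.b₁_pos
    have := h.a₁_pos
    have := h.pos
    have := h.nonneg
    positivity
  exact nonneg_of_mul_nonneg_right h1 h.l₁_pos

/-- The gap `Ŝ_F - S_F` of a qubit pair, `F` being the values of the function. -/
def gap (F : ℝ → ℝ) (a₁ a₂ b₁ b₂ t l₁ l₂ : ℝ) : ℝ :=
  ((a₁ + a₂) - l₂ * (b₁ + b₂)) / (l₁ - l₂) * F l₁
    + (l₁ * (b₁ + b₂) - (a₁ + a₂)) / (l₁ - l₂) * F l₂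
    - (b₁ * F (a₁ / b₁) * t + b₂ * F (a₁ / b₂) * (1 - t)
      + (b₁ * F (a₂ / b₁) * (1 - t) + b₂ * F (a₂ / b₂) * t))

/-- On the function `x ↦ 1 / (x + s)` this is the partial fraction expansion of
`C * s * (a₁ / (a₁ / b₁ + s) + a₂ / (a₂ / b₂ + s)) /
  ((l₁ + s) * (l₂ + s) * (a₁ / b₂ + s) * (a₂ / b₁ + s))`. -/
lemma gap_eq (h : IsQubitData a₁ a₂ b₁ b₂ t l₁ l₂) (ha₂ : 0 < a₂) (F : ℝ → ℝ) :
    gap F a₁ a₂ b₁ b₂ t l₁ l₂ = -(t * (1 - t) * (a₁ - a₂) ^ 2 * (b₁ - b₂) ^ 2 / (b₁ * b₂) ^ 2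
      * (a₁ * divDiff {a₂ / b₁, l₂, a₁ / b₁, l₁, a₁ / b₂} (fun x => x * F x)
        + a₂ * divDiff {a₂ / b₁, l₂, a₂ / b₂, l₁, a₁ / b₂} (fun x => x * F x))) := by
  set K := t * (1 - t) * (a₁ - a₂) ^ 2 * (b₁ - b₂) ^ 2 / (b₁ * b₂) ^ 2 with hK
  have hb₁ := h.b₁_pos.ne'
  have hb₂ := h.pos.ne'
  have ha₁ := h.a₁_pos.ne'
  have ha₂' := ha₂.ne'
  have ht := h.t_pos.ne'
  have ht1 := (sub_pos.2 h.t_lt).ne'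
  have ha := (sub_pos.2 h.a_lt).ne'
  have hb := (sub_pos.2 h.b_lt).ne'
  have hab : a₁ * b₁ - a₂ * b₂ ≠ 0 :=
    (sub_pos.2 (mul_lt_mul h.a_lt h.b_lt.le h.pos h.a₁_pos.le)).ne'
  -- differences of the quotients
  have d1 : a₂ / b₁ - a₁ / b₁ = -((a₁ - a₂) / b₁) := by field_simp; ring
  have d2 : a₂ / b₁ - a₂ / b₂ = -(a₂ * (b₁ - b₂) / (b₁ * b₂)) := by field_simp; ring
  have d3 : a₂ / b₁ - a₁ / b₂ = -((a₁ * b₁ - a₂ * b₂) / (b₁ * b₂)) := by field_simp; ring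
  have d4 : a₁ / b₂ - a₁ / b₁ = a₁ * (b₁ - b₂) / (b₁ * b₂) := by field_simp
  have d5 : a₁ / b₂ - a₂ / b₂ = (a₁ - a₂) / b₂ := by field_simp
  have e21 : K * (a₂ / b₁ / ((a₂ / b₁ - l₁) * (a₂ / b₁ - l₂) * (a₂ / b₁ - a₁ / b₂)))
      * (a₁ / (a₂ / b₁ - a₁ / b₁) + a₂ / (a₂ / b₁ - a₂ / b₂)) = b₁ * (1 - t) := by
    rw [h.sub_mul_sub_21, d1, d2, d3, hK]
    field_simp
    ring
  have e12 : K * (a₁ / b₂ / ((a₁ / b₂ - l₁) * (a₁ / b₂ - l₂) * (a₁ / b₂ - a₂ / b₁)))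
      * (a₁ / (a₁ / b₂ - a₁ / b₁) + a₂ / (a₁ / b₂ - a₂ / b₂)) = b₂ * (1 - t) := by
    rw [h.sub_mul_sub_12, d4, d5, ← neg_sub (a₂ / b₁), d3, hK]
    field_simp
    ring
  have e11 : K * a₁ * (a₁ / b₁ / ((a₁ / b₁ - l₁) * (a₁ / b₁ - l₂)
      * (a₁ / b₁ - a₂ / b₁) * (a₁ / b₁ - a₁ / b₂))) = b₁ * t := by
    rw [h.sub_mul_sub_11, ← neg_sub (a₂ / b₁), d1, ← neg_sub (a₁ / b₂), d4, hK]
    field_simp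
  have e22 : K * a₂ * (a₂ / b₂ / ((a₂ / b₂ - l₁) * (a₂ / b₂ - l₂)
      * (a₂ / b₂ - a₂ / b₁) * (a₂ / b₂ - a₁ / b₂))) = b₂ * t := by
    rw [h.sub_mul_sub_22, ← neg_sub (a₂ / b₁), d2, ← neg_sub (a₁ / b₂), d5, hK]
    field_simp
  have o1 := h.lt_21 ha₂
  obtain ⟨o2, o3⟩ := h.between_11
  obtain ⟨o4, o5⟩ := h.between_22 ha₂
  have o6 := h.lt_12
  have m1 : b₁ * (a₁ / b₁) = a₁ := mul_div_cancel₀ _ hb₁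
  have m2 : b₁ * (a₂ / b₁) = a₂ := mul_div_cancel₀ _ hb₁
  have m3 : b₂ * (a₁ / b₂) = a₁ := mul_div_cancel₀ _ hb₂
  have m4 : b₂ * (a₂ / b₂) = a₂ := mul_div_cancel₀ _ hb₂
  clear d1 d2 d3 d4 d5
  clear_value K
  rw [gap]
  generalize a₂ / b₁ = x₁ at *
  generalize a₁ / b₁ = p at *
  generalize a₂ / b₂ = q at *
  generalize a₁ / b₂ = x₅ at *
  -- the functional on the right, with the coefficients `u`, `v` at `l₁`, `l₂` left implicit
  obtain ⟨u, v, huv⟩ : ∃ u v : ℝ, ∀ G : ℝ → ℝ,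
      -(K * (a₁ * divDiff {x₁, l₂, p, l₁, x₅} (fun x => x * G x)
        + a₂ * divDiff {x₁, l₂, q, l₁, x₅} (fun x => x * G x))) = u * G l₁ + v * G l₂
      - (b₁ * G p * t + b₂ * G x₅ * (1 - t) + (b₁ * G x₁ * (1 - t) + b₂ * G q * t)) := by
    refine ⟨-(K * (a₁ * (l₁ / ((l₁ - x₁) * (l₁ - l₂) * (l₁ - p) * (l₁ - x₅)))
      + a₂ * (l₁ / ((l₁ - x₁) * (l₁ - l₂) * (l₁ - q) * (l₁ - x₅))))),
      -(K * (a₁ * (l₂ / ((l₂ - x₁) * (l₂ - p) * (l₂ - l₁) * (l₂ - x₅)))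
      + a₂ * (l₂ / ((l₂ - x₁) * (l₂ - q) * (l₂ - l₁) * (l₂ - x₅))))), fun G => ?_⟩
    rw [divDiff_five o1 o2 o3 o6, divDiff_five o1 o4 o5 o6]
    simp only [div_eq_mul_inv, mul_inv] at e21 e12 e11 e22 ⊢
    linear_combination -G x₁ * e21 - G x₅ * e12 - G p * e11 - G q * e22
  have z0 : ∀ y, l₂ < y → y < l₁ → divDiff {x₁, l₂, y, l₁, x₅} (fun x => x * 1) = 0 := by
    intro y hy1 hy2
    have := divDiff_eval (r := Polynomial.X) (card_five o1 hy1 hy2 o6) (by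
      rw [Polynomial.degree_X]; norm_num)
    simpa using this
  have z1 : ∀ y, l₂ < y → y < l₁ → divDiff {x₁, l₂, y, l₁, x₅} (fun x => x * x) = 0 := by
    intro y hy1 hy2
    have := divDiff_eval (r := Polynomial.X ^ 2) (card_five o1 hy1 hy2 o6) (by
      rw [Polynomial.degree_X_pow]; norm_num)
    simpa [pow_two] using this
  have w0 := huv fun _ => 1
  have w1 := huv fun x => x
  rw [z0 p o2 o3, z0 q o4 o5] at w0
  rw [z1 p o2 o3, z1 q o4 o5] at w1
  obtain ⟨hu, hv⟩ := coeff_eq_of_moments (u := u) (v := v) (α := a₁ + a₂) (β := b₁ + b₂)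
    h.l_lt.ne' (by linarith)
    (by linear_combination -w1 + t * m1 + (1 - t) * m3 + (1 - t) * m2 + t * m4)
  rw [huv, hu, hv]

end IsQubitData

end Gap

/-! ### Positivity of the gap -/

section GapPos

variable {a₁ a₂ b₁ b₂ t l₁ l₂ : ℝ}

lemma IsQubitData.gap_update_pos (h : IsQubitData a₁ a₂ b₁ b₂ t l₁ l₂) {f : ℝ → ℝ}
    (hf : OperatorConvex f) {c : ℝ} (hc : Tendsto f (𝓝[>] 0) (𝓝 c)) (hnp : ¬ IsPolynomial f) :
    0 < gap (Function.update f 0 c) a₁ a₂ b₁ b₂ t l₁ l₂ := by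
  have ht := h.t_pos
  have ht1 := sub_pos.2 h.t_lt
  have hp0 : 0 < a₁ / b₁ := div_pos h.a₁_pos h.b₁_pos
  obtain ⟨o2, o3⟩ := h.between_11
  have o6 := h.lt_12
  rcases h.nonneg.lt_or_eq with ha₂ | ha₂
  · have hx0 : 0 < a₂ / b₁ := div_pos ha₂ h.b₁_pos
    have o1 := h.lt_21 ha₂
    obtain ⟨o4, o5⟩ := h.between_22 ha₂
    have hneg : ∀ y, l₂ < y → y < l₁ → divDiff {a₂ / b₁, l₂, y, l₁, a₁ / b₂}
        (fun x => x * Function.update f 0 c x) < 0 := by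
      intro y hy1 hy2
      have hpos : ∀ x ∈ ({a₂ / b₁, l₂, y, l₁, a₁ / b₂} : Finset ℝ), 0 < x := by
        intro x hx
        simp only [Finset.mem_insert, Finset.mem_singleton] at hx
        rcases hx with rfl | rfl | rfl | rfl | rfl <;> linarith
      rw [divDiff_congr (h := fun x => x * f x) fun x hx => by
        rw [Function.update_of_ne (hpos x hx).ne']]
      exact hf.divDiff_id_mul_neg hc hnp (card_five o1 hy1 hy2 o6) hpos
    rw [h.gap_eq ha₂, neg_pos]
    have k1 := mul_neg_of_pos_of_neg h.a₁_pos (hneg _ o2 o3)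
    have k2 := mul_neg_of_pos_of_neg ha₂ (hneg _ o4 o5)
    refine mul_neg_of_pos_of_neg ?_ (add_neg k1 k2)
    have := sub_pos.2 h.a_lt
    have := sub_pos.2 h.b_lt
    have := h.b₁_pos
    have := h.pos
    positivity
  · -- a rank-one `A`: the gap is the strict concavity of the slope of `f` from `0`
    subst ha₂
    have hb₁ := h.b₁_pos.ne'
    have hb₂ := h.pos.ne'
    have hl₁ := h.l₁_pos.ne'
    have hl₂ : l₂ = 0 := by
      have := h.mul
      rw [relDet, mul_zero, zero_div] at this
      exact (mul_eq_zero.1 this).resolve_left hl₁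
    have hl : l₁ = a₁ / b₁ * t + a₁ / b₂ * (1 - t) := by
      have := h.add
      rw [relTrace, hl₂] at this
      simpa using this
    have hpos : ∀ x ∈ ({a₁ / b₁, l₁, a₁ / b₂} : Finset ℝ), 0 < x := by
      intro x hx
      simp only [Finset.mem_insert, Finset.mem_singleton] at hx
      rcases hx with rfl | rfl | rfl <;> linarith
    have hcard : ({a₁ / b₁, l₁, a₁ / b₂} : Finset ℝ).card = 3 := by
      rw [Finset.card_insert_of_notMem (by grind), Finset.card_pair (by grind)]
    have hneg := hf.divDiff_slope_neg hc hnp hcard hpos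
    have hgap : gap (Function.update f 0 c) a₁ 0 b₁ b₂ t l₁ l₂
        = -(a₁ * t * (1 - t) * (a₁ / b₂ - a₁ / b₁) ^ 2
          * divDiff {a₁ / b₁, l₁, a₁ / b₂} fun x => (f x - c) / x) := by
      have s1 : a₁ / b₁ - l₁ = -((1 - t) * (a₁ / b₂ - a₁ / b₁)) := by rw [hl]; ring
      have s2 : a₁ / b₂ - l₁ = t * (a₁ / b₂ - a₁ / b₁) := by rw [hl]; ring
      have s3 : a₁ / b₂ - a₁ / b₁ ≠ 0 := by
        have := o3.trans o6
        exact (sub_pos.2 this).ne'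
      have e : ∀ x : ℝ, 0 < x → f x = c + x * ((f x - c) / x) := fun x hx => by
        rw [mul_div_cancel₀ _ hx.ne']; ring
      rw [divDiff_three o3 o6, gap, hl₂, zero_div, zero_div, Function.update_self,
        Function.update_of_ne hl₁, Function.update_of_ne hp0.ne',
        Function.update_of_ne (hp0.trans (o3.trans o6)).ne', e l₁ h.l₁_pos, e _ hp0,
        e (a₁ / b₂) (hp0.trans (o3.trans o6))]
      simp only [add_sub_cancel_left, mul_div_cancel_left₀ _ hl₁, mul_div_cancel_left₀ _ hp0.ne',
        mul_div_cancel_left₀ _ (hp0.trans (o3.trans o6)).ne']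
      generalize (f l₁ - c) / l₁ = u
      generalize (f (a₁ / b₁) - c) / (a₁ / b₁) = v
      generalize (f (a₁ / b₂) - c) / (a₁ / b₂) = w
      rw [← neg_sub (a₁ / b₁) l₁, ← neg_sub (a₁ / b₂) l₁, s1, s2,
        ← neg_sub (a₁ / b₂) (a₁ / b₁)]
      have := ht.ne'
      have := ht1.ne'
      have m1 : b₁ * (a₁ / b₁) = a₁ := mul_div_cancel₀ _ hb₁
      have m3 : b₂ * (a₁ / b₂) = a₁ := mul_div_cancel₀ _ hb₂
      generalize a₁ / b₁ = p at *
      generalize a₁ / b₂ = q at *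
      have hr : a₁ * t * (1 - t) * (q - p) ^ 2 * (v / (-((1 - t) * (q - p)) * -(q - p))
          + u / (- -((1 - t) * (q - p)) * -(t * (q - p))) + w / ((q - p) * (t * (q - p))))
          = a₁ * (t * v - u + (1 - t) * w) := by
        field_simp
        ring
      rw [hr]
      field_simp
      linear_combination (-(t * v) * l₁) * m1 - ((1 - t) * w * l₁) * m3
    rw [hgap, neg_pos]
    refine mul_neg_of_pos_of_neg ?_ hneg
    have := sub_pos.2 (o3.trans o6)
    have := h.a₁_pos
    positivity

end GapPos

/-! ### Limits -/

lemma OperatorConvex.convexOn {f : ℝ → ℝ} (hf : OperatorConvex f) :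
    ConvexOn ℝ (Set.Ioi 0) f := by
  refine ⟨convex_Ioi 0, fun x hx y hy α β hα hβ hαβ => ?_⟩
  obtain rfl : β = 1 - α := by linarith
  have hpd : ∀ z : ℝ, 0 < z →
      (Matrix.diagonal fun _ => (z : ℂ) : Matrix (Fin 1) (Fin 1) ℂ).PosDef := fun z hz =>
    Matrix.PosDef.diagonal fun _ => by simpa using hz
  have h := hf 1 _ _ (hpd x hx) (hpd y hy) α hα (by linarith)
  rw [show α • (Matrix.diagonal fun _ => (x : ℂ) : Matrix (Fin 1) (Fin 1) ℂ)
      + (1 - α) • (Matrix.diagonal fun _ => (y : ℂ))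
      = Matrix.diagonal fun _ => ((α * x + (1 - α) * y : ℝ) : ℂ) by
    ext i j
    obtain rfl := Subsingleton.elim i j
    simp, cfc_diagonal, cfc_diagonal, cfc_diagonal] at h
  have h' := h.diag_nonneg (i := 0)
  simp only [Matrix.sub_apply, Matrix.add_apply, Matrix.smul_apply, Matrix.diagonal_apply_eq,
    Complex.real_smul] at h'
  have h'' : 0 ≤ α * f x + (1 - α) * f y - f (α * x + (1 - α) * y) := by exact_mod_cast h'
  simp only [smul_eq_mul]
  linarith

lemma tendsto_comp_update {f : ℝ → ℝ} (hf : ContinuousOn f (Set.Ioi 0)) {c : ℝ}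
    (hc : Tendsto f (𝓝[>] 0) (𝓝 c)) {u : ℝ → ℝ} {u₀ : ℝ} (hu : Tendsto u (𝓝[>] 0) (𝓝 u₀))
    (hpos : ∀ ε, 0 < ε → 0 < u ε) (hu₀ : 0 ≤ u₀) :
    Tendsto (fun ε => f (u ε)) (𝓝[>] 0) (𝓝 (Function.update f 0 c u₀)) := by
  rcases hu₀.lt_or_eq with h | h
  · rw [Function.update_of_ne h.ne']
    exact (hf.continuousAt (Ioi_mem_nhds h)).tendsto.comp hu
  · subst h
    rw [Function.update_self]
    refine hc.comp (tendsto_nhdsWithin_iff.2 ⟨hu, ?_⟩)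
    filter_upwards [self_mem_nhdsWithin] with ε hε using hpos ε hε

/-- The two eigenvalues of `B^{-1/2} A B^{-1/2}`, by the quadratic formula. -/
lemma isQubitData_sqrt {a₁ a₂ b₁ b₂ t : ℝ} (ht0 : 0 < t) (ht1 : t < 1) (ha₂ : 0 ≤ a₂)
    (ha : a₂ < a₁) (hb₂ : 0 < b₂) (hb : b₂ < b₁) :
    IsQubitData a₁ a₂ b₁ b₂ t
      ((relTrace a₁ a₂ b₁ b₂ t + √(relTrace a₁ a₂ b₁ b₂ t ^ 2 - 4 * relDet a₁ a₂ b₁ b₂)) / 2)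
      ((relTrace a₁ a₂ b₁ b₂ t - √(relTrace a₁ a₂ b₁ b₂ t ^ 2 - 4 * relDet a₁ a₂ b₁ b₂)) / 2) where
  t_pos := ht0
  t_lt := ht1
  nonneg := ha₂
  a_lt := ha
  pos := hb₂
  b_lt := hb
  l_lt := by have := Real.sqrt_pos.2 (discr_pos ht1 ha₂ ha hb₂ hb); linarith
  add := by ring
  mul := by
    have := Real.sq_sqrt (discr_pos ht1 ha₂ ha hb₂ hb).le
    linear_combination -this / 4

section Main

variable {ρ γ : Matrix (Fin 2) (Fin 2) ℂ}

lemma exists_ordered_isSpectralDecomp (hρ : ρ.PosSemidef) {X : Matrix (Fin 2) (Fin 2) ℂ}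
    (hX : ρ * X ≠ X * ρ) : ∃ a P, IsSpectralDecomp ρ a P ∧ 0 ≤ a 1 ∧ a 1 < a 0 := by
  obtain ⟨P, hP⟩ := exists_isSpectralDecomp hρ.isHermitian
  have hnn := hρ.eigenvalues_nonneg
  rcases lt_trichotomy (hρ.isHermitian.eigenvalues 0) (hρ.isHermitian.eigenvalues 1)
    with h | h | h
  · exact ⟨_, _, hP.comp_equiv (Equiv.swap 0 1), by simpa using hnn 0, by simpa using h⟩
  · refine absurd ?_ hX
    have h1 : ρ = hρ.isHermitian.eigenvalues 0 • (1 : Matrix (Fin 2) (Fin 2) ℂ) := by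
      conv_lhs => rw [hP.eq_sum]
      rw [Fin.sum_univ_two, ← h, ← smul_add, ← Fin.sum_univ_two, hP.sum_eq]
    rw [h1]
    simp
  · exact ⟨_, _, hP, hnn 1, h⟩

lemma pos_of_support_le {a b : Fin 2 → ℝ} {P Q : Fin 2 → Matrix (Fin 2) (Fin 2) ℂ}
    (hP : IsSpectralDecomp ρ a P) (hQ : IsSpectralDecomp γ b Q) (hργ : ρ * γ ≠ γ * ρ)
    (ha1 : 0 ≤ a 1) (ha : a 1 < a 0) (hb1 : 0 ≤ b 1) (hb : b 1 < b 0)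
    (hsupp : (psdPow γ 0 - psdPow ρ 0).PosSemidef) : 0 < b 1 := by
  by_contra hb0
  have hγ0 : psdPow γ 0 = Q 0 := by
    rw [psdPow, hQ.cfc_eq, Fin.sum_univ_two, if_pos (hb1.trans_lt hb), if_neg hb0]
    simp
  have hρ0 : psdPow ρ 0 = P 0 + (if 0 < a 1 then (1 : ℝ) else 0) • P 1 := by
    rw [psdPow, hP.cfc_eq, Fin.sum_univ_two, if_pos (ha1.trans_lt ha)]
    simp
  have htr := hsupp.trace_nonneg
  rw [hγ0, hρ0, Matrix.trace_sub, Matrix.trace_add, Matrix.trace_smul, hQ.trace_eq, hP.trace_eq,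
    hP.trace_eq] at htr
  split_ifs at htr hρ0 with h0
  · norm_num at htr
  · rw [hγ0, hρ0, zero_smul, add_zero] at hsupp
    have h1 : (Q 0 - P 0).trace = 0 := by
      rw [Matrix.trace_sub, hQ.trace_eq, hP.trace_eq, sub_self]
    have h2 : Q 0 = P 0 := sub_eq_zero.1 (hsupp.trace_eq_zero_iff.1 h1)
    have h3 : Commute (P 0) (Q 0) := by rw [h2]
    exact hργ (hP.commute_of_commute hQ h3)

/-- The qubit case in real numbers: both regularized divergences converge, and the limits differ
by a positive gap. -/
theorem exists_tendsto_stdDivPos_maxDivPos {f : ℝ → ℝ} (hf : OperatorConvex f) {c : ℝ}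
    (hc : Tendsto f (𝓝[>] 0) (𝓝 c)) (hnp : ¬ IsPolynomial f) (hρ : ρ.PosSemidef)
    (hγ : γ.PosSemidef) (hργ : ρ * γ ≠ γ * ρ)
    (hsupp : (psdPow γ 0 - psdPow ρ 0).PosSemidef) :
    ∃ S M : ℝ, S < M ∧
      Tendsto (fun ε : ℝ => stdDivPos f (ρ + ε • (1 : Matrix (Fin 2) (Fin 2) ℂ))
        (γ + ε • (1 : Matrix (Fin 2) (Fin 2) ℂ))) (𝓝[>] 0) (𝓝 S) ∧
      Tendsto (fun ε : ℝ => maxDivPos f (ρ + ε • (1 : Matrix (Fin 2) (Fin 2) ℂ))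
        (γ + ε • (1 : Matrix (Fin 2) (Fin 2) ℂ))) (𝓝[>] 0) (𝓝 M) := by
  obtain ⟨a, P, hP, ha1, ha⟩ := exists_ordered_isSpectralDecomp hρ hργ
  obtain ⟨b, Q, hQ, hb1', hb⟩ := exists_ordered_isSpectralDecomp hγ hργ.symm
  have hb1 := pos_of_support_le hP hQ hργ ha1 ha hb1' hb hsupp
  have hb0 := hb1.trans hb
  have hcont : ContinuousOn f (Set.Ioi 0) := hf.convexOn.continuousOn isOpen_Ioi
  set t := (P 0 * Q 0).trace.re with ht
  obtain ⟨t01, t10, t11⟩ := hP.overlap_two hQ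
  have ht0 : 0 < t := hP.overlap_pos hQ hργ 0 0
  have ht1 : t < 1 := by have := hP.overlap_pos hQ hργ 0 1; linarith
  set s : ℝ → ℝ := fun ε => relTrace (a 0 + ε) (a 1 + ε) (b 0 + ε) (b 1 + ε) t with hs
  set d : ℝ → ℝ := fun ε => relDet (a 0 + ε) (a 1 + ε) (b 0 + ε) (b 1 + ε) with hd
  set l₁ : ℝ → ℝ := fun ε => (s ε + √(s ε ^ 2 - 4 * d ε)) / 2 with hl₁
  set l₂ : ℝ → ℝ := fun ε => (s ε - √(s ε ^ 2 - 4 * d ε)) / 2 with hl₂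
  have hdata : ∀ ε, 0 ≤ ε →
      IsQubitData (a 0 + ε) (a 1 + ε) (b 0 + ε) (b 1 + ε) t (l₁ ε) (l₂ ε) := fun ε hε =>
    isQubitData_sqrt ht0 ht1 (by linarith) (by linarith) (by linarith) (by linarith)
  have hd0 : IsQubitData (a 0) (a 1) (b 0) (b 1) t (l₁ 0) (l₂ 0) := by
    simpa using hdata 0 le_rfl
  have hb0n : b 0 + 0 ≠ 0 := by rw [add_zero]; exact hb0.ne'
  have hb1n : b 1 + 0 ≠ 0 := by rw [add_zero]; exact hb1.ne'
  have hsc : ContinuousAt s 0 := by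
    simp only [hs, relTrace]
    fun_prop (disch := assumption)
  have hdc : ContinuousAt d 0 := by
    simp only [hd, relDet]
    fun_prop (disch := first | assumption | exact mul_ne_zero hb0n hb1n)
  have hl₁c : ContinuousAt l₁ 0 := by simp only [hl₁]; fun_prop
  have hl₂c : ContinuousAt l₂ 0 := by simp only [hl₂]; fun_prop
  set F := Function.update f 0 c with hF
  have hlim : ∀ {u : ℝ → ℝ}, ContinuousAt u 0 → Tendsto u (𝓝[>] 0) (𝓝 (u 0)) := fun hu =>
    hu.tendsto.mono_left nhdsWithin_le_nhds
  have hquot : ∀ i j, Tendsto (fun ε => (b j + ε) * f ((a i + ε) / (b j + ε))) (𝓝[>] 0)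
      (𝓝 (b j * F (a i / b j))) := by
    have hai : ∀ i, 0 ≤ a i := Fin.forall_fin_two.2 ⟨(ha1.trans_lt ha).le, ha1⟩
    have hbj : ∀ j, 0 < b j := Fin.forall_fin_two.2 ⟨hb0, hb1⟩
    intro i j
    have hbj0 : b j + 0 ≠ 0 := by rw [add_zero]; exact (hbj j).ne'
    have h1 : Tendsto (fun ε => b j + ε) (𝓝[>] 0) (𝓝 (b j)) := by
      simpa using hlim (u := fun ε => b j + ε) (by fun_prop)
    have h2 : Tendsto (fun ε => (a i + ε) / (b j + ε)) (𝓝[>] 0) (𝓝 (a i / b j)) := by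
      simpa using hlim (u := fun ε => (a i + ε) / (b j + ε)) (by fun_prop (disch := assumption))
    refine h1.mul (tendsto_comp_update hcont hc h2 (fun ε hε => ?_)
      (div_nonneg (hai i) (hbj j).le))
    exact div_pos (by linarith [hai i]) (by linarith [hbj j])
  refine ⟨b 0 * F (a 0 / b 0) * t + b 1 * F (a 0 / b 1) * (1 - t)
      + (b 0 * F (a 1 / b 0) * (1 - t) + b 1 * F (a 1 / b 1) * t),
    ((a 0 + a 1) - l₂ 0 * (b 0 + b 1)) / (l₁ 0 - l₂ 0) * F (l₁ 0)
      + (l₁ 0 * (b 0 + b 1) - (a 0 + a 1)) / (l₁ 0 - l₂ 0) * F (l₂ 0), ?_, ?_, ?_⟩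
  · exact sub_pos.1 (hd0.gap_update_pos hf hc hnp)
  · have h := (((hquot 0 0).mul_const t).add ((hquot 0 1).mul_const (1 - t))).add
      (((hquot 1 0).mul_const (1 - t)).add ((hquot 1 1).mul_const t))
    refine h.congr' ?_
    filter_upwards [self_mem_nhdsWithin] with ε hε
    have hε : 0 < ε := hε
    rw [stdDivPos_eq f (hP.add_smul_one ε) (hQ.add_smul_one ε)
      (Fin.forall_fin_two.2 ⟨by linarith, by linarith⟩)]
    simp only [Fin.sum_univ_two, t01, t10, t11, ht]
  · have hw : ∀ {u v : ℝ → ℝ}, ContinuousAt u 0 → ContinuousAt v 0 →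
        Tendsto (fun ε => (u ε - v ε) / (l₁ ε - l₂ ε)) (𝓝[>] 0)
          (𝓝 ((u 0 - v 0) / (l₁ 0 - l₂ 0))) := fun hu hv =>
      hlim ((hu.sub hv).div (hl₁c.sub hl₂c) (sub_pos.2 hd0.l_lt).ne')
    have hf1 := tendsto_comp_update hcont hc (hlim hl₁c) (fun ε hε => (hdata ε hε.le).l₁_pos)
      hd0.l₁_pos.le
    have hf2 := tendsto_comp_update hcont hc (hlim hl₂c) (fun ε hε => by
      have h1 := hdata ε hε.le
      exact (div_pos (by linarith : 0 < a 1 + ε) h1.b₁_pos).trans (h1.lt_21 (by linarith)))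
      hd0.l₂_nonneg
    have h1 := hw (u := fun ε => (a 0 + ε) + (a 1 + ε))
      (v := fun ε => l₂ ε * ((b 0 + ε) + (b 1 + ε))) (by fun_prop) (by fun_prop)
    have h2 := hw (u := fun ε => l₁ ε * ((b 0 + ε) + (b 1 + ε)))
      (v := fun ε => (a 0 + ε) + (a 1 + ε)) (by fun_prop) (by fun_prop)
    have h := (h1.mul hf1).add (h2.mul hf2)
    simp only [add_zero] at h
    refine h.congr' ?_
    filter_upwards [self_mem_nhdsWithin] with ε hε
    have hε : 0 < ε := hε
    have h3 := hdata ε hε.le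
    rw [maxDivPos_eq f (hP.add_smul_one ε) (hQ.add_smul_one ε)
      (Fin.forall_fin_two.2 ⟨by linarith, by linarith⟩) h3.l_lt.ne' (by
        rw [h3.add, relTrace]
        simp only [Fin.sum_univ_two, t01, t10, t11, ht]) h3.mul]

end Main

/-! ### The representing measure -/

open Polynomial in
/-- A nonzero representing measure contributes `x * (x - 1) * J x`, where `J` is positive and
tends to `0` at infinity; no polynomial behaves like that. -/
theorem IsRepresentation.eq_zero_of_isPolynomial {f : ℝ → ℝ} {a b : ℝ}
    {μ : Measure (Set.Ioi (0 : ℝ))} (h : IsRepresentation f a b μ) (hp : IsPolynomial f) :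
    μ = 0 := by
  obtain ⟨p, hp⟩ := hp
  obtain ⟨c, hc, hfx⟩ := h.eq
  set J : ℝ → ℝ := fun x => ∫ s : Set.Ioi (0 : ℝ), ((1 + (s : ℝ)) * (x + s))⁻¹ ∂μ with hJ
  set r : ℝ[X] := p - C c - C a * X - C b * X ^ 2 with hr
  have hrJ : ∀ x, 0 < x → r.eval x = x * (x - 1) * J x := by
    intro x hx
    have h1 : r.eval x = ∫ s : Set.Ioi (0 : ℝ), (x / (1 + (s : ℝ)) - x / (x + (s : ℝ))) ∂μ := by
      have := hfx x hx
      rw [hp x hx] at this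
      simp only [hr, eval_sub, eval_mul, eval_C, eval_X, eval_pow]
      linarith
    rw [h1, hJ, ← integral_const_mul]
    refine integral_congr_ae (Eventually.of_forall fun s => ?_)
    have hs : 0 < (s : ℝ) := s.2
    have e1 : (1 + (s : ℝ)) ≠ 0 := by positivity
    have e2 : x + (s : ℝ) ≠ 0 := by positivity
    simp only
    field_simp
    ring
  have hmeas : ∀ x : ℝ, AEStronglyMeasurable
      (fun s : Set.Ioi (0 : ℝ) => ((1 + (s : ℝ)) * (x + s))⁻¹) μ := fun x => by
    refine Measurable.aestronglyMeasurable ?_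
    fun_prop
  have hbound : ∀ x : ℝ, 1 ≤ x → ∀ s : Set.Ioi (0 : ℝ),
      ‖((1 + (s : ℝ)) * (x + s))⁻¹‖ ≤ ((1 + (s : ℝ)) ^ 2)⁻¹ := by
    intro x hx s
    have hs : 0 < (s : ℝ) := s.2
    rw [Real.norm_of_nonneg (by positivity)]
    refine inv_anti₀ (by positivity) ?_
    rw [pow_two]
    gcongr
  have hJ0 : Tendsto J atTop (𝓝 0) := by
    have := tendsto_integral_filter_of_dominated_convergence (μ := μ) (l := atTop)
      (F := fun (x : ℝ) (s : Set.Ioi (0 : ℝ)) => ((1 + (s : ℝ)) * (x + s))⁻¹) (f := fun _ => 0)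
      (fun s : Set.Ioi (0 : ℝ) => ((1 + (s : ℝ)) ^ 2)⁻¹) (Eventually.of_forall hmeas)
      (by filter_upwards [eventually_ge_atTop 1] with x hx using
            Eventually.of_forall (hbound x hx))
      h.integrable (Eventually.of_forall fun s => by
        have hs : 0 < (s : ℝ) := s.2
        exact (Tendsto.const_mul_atTop (by positivity)
          (tendsto_atTop_add_const_right _ _ tendsto_id)).inv_tendsto_atTop)
    rwa [integral_zero] at this
  have hdeg : r.degree < 2 := by
    have hQ : (X * (X - C 1) : ℝ[X]).degree = 2 := by
      rw [degree_mul, degree_X, degree_X_sub_C]; norm_num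
    rw [← hQ, ← div_tendsto_atTop_zero_iff_degree_lt _ _ (by
      intro h0; rw [h0, degree_zero] at hQ; exact absurd hQ (by decide))]
    refine hJ0.congr' ?_
    filter_upwards [eventually_gt_atTop 1] with x hx
    have e1 : x ≠ 0 := by linarith
    have e2 : x - 1 ≠ 0 := by linarith
    rw [hrJ x (by linarith)]
    simp only [eval_mul, eval_X, eval_sub, eval_C]
    rw [mul_div_cancel_left₀ _ (mul_ne_zero e1 e2)]
  have hr0 : r.eval 0 = 0 := by
    have t2 : Tendsto (fun x => p.eval x) (𝓝[>] 0) (𝓝 (p.eval 0)) :=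
      p.continuous.continuousAt.tendsto.mono_left nhdsWithin_le_nhds
    have : p.eval 0 = c := by
      refine tendsto_nhds_unique t2 (hc.congr' ?_)
      filter_upwards [self_mem_nhdsWithin] with x hx using hp x hx
    simp [hr, this]
  have hr1 : r.eval 1 = 0 := by rw [hrJ 1 one_pos]; ring
  have hrz : r = 0 := eq_zero_of_degree_lt_of_eval_finset_eq_zero {0, 1} (by
      rw [Finset.card_pair zero_ne_one]; exact hdeg) (by
    intro x hx
    simp only [Finset.mem_insert, Finset.mem_singleton] at hx
    rcases hx with rfl | rfl
    exacts [hr0, hr1])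
  have hJ2 : J 2 = 0 := by
    have := hrJ 2 two_pos
    rw [hrz, eval_zero] at this
    linarith
  rw [hJ, integral_eq_zero_iff_of_nonneg (fun s => by
    have hs : 0 < (s : ℝ) := s.2
    simp only [Pi.zero_apply]
    positivity) (h.integrable.mono' (hmeas 2) (Eventually.of_forall (hbound 2 one_le_two)))] at hJ2
  rw [← ae_eq_bot, ← eventually_false_iff_eq_bot]
  filter_upwards [hJ2] with s hs
  have hs' : 0 < (s : ℝ) := s.2
  have : 0 < ((1 + (s : ℝ)) * (2 + s))⁻¹ := by positivity
  exact this.ne' hs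

theorem IsRepresentation.not_isPolynomial_iff {f : ℝ → ℝ} {a b : ℝ}
    {μ : Measure (Set.Ioi (0 : ℝ))} (h : IsRepresentation f a b μ) :
    ¬ IsPolynomial f ↔ μ.support.Nonempty := by
  rw [Measure.nonempty_support_iff]
  refine not_congr ⟨h.eq_zero_of_isPolynomial, fun hμ => ?_⟩
  obtain ⟨c, -, hfx⟩ := h.eq
  refine ⟨Polynomial.C c + Polynomial.C a * Polynomial.X
    + Polynomial.C b * Polynomial.X ^ 2, fun x hx => ?_⟩
  rw [hfx x hx, hμ, integral_zero_measure]
  simp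

end QuantumDivergence

end

/-- Let `f` be operator convex on `(0, ∞)` with finite `f(0⁺)` (i.e. operator convex on `[0, ∞)`).
Being no polynomial means that the representing measure of `f` has nonempty support, and for such
`f` the strict inequality `S_f(ρ‖γ) < Ŝ_f(ρ‖γ)` holds for all non-commuting positive qubit
operators with `ρ⁰ ≤ γ⁰`; both limits defining the divergences exist. -/
theorem proposition4p5 (f : ℝ → ℝ)
    (hf : QuantumDivergence.OperatorConvex f)
    (hf0 : ∃ c : ℝ, Tendsto f (𝓝[>] 0) (𝓝 c)) :
    (∀ (a b : ℝ) (μ : Measure (Set.Ioi (0 : ℝ))),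
      QuantumDivergence.IsRepresentation f a b μ →
        (¬ QuantumDivergence.IsPolynomial f ↔ μ.support.Nonempty)) ∧
    (¬ QuantumDivergence.IsPolynomial f →
      ∀ ρ γ : Matrix (Fin 2) (Fin 2) ℂ, ρ.PosSemidef → γ.PosSemidef →
        ρ * γ ≠ γ * ρ →
        (QuantumDivergence.psdPow γ 0 - QuantumDivergence.psdPow ρ 0).PosSemidef →
        Tendsto (QuantumDivergence.stdDivReg f ρ γ) (𝓝[>] 0)
            (𝓝 (QuantumDivergence.stdDiv f ρ γ)) ∧
        Tendsto (QuantumDivergence.maxDivReg f ρ γ) (𝓝[>] 0)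
            (𝓝 (QuantumDivergence.maxDiv f ρ γ)) ∧
        QuantumDivergence.stdDiv f ρ γ < QuantumDivergence.maxDiv f ρ γ) := by

  obtain ⟨c, hc⟩ := hf0
  refine ⟨fun a b μ h => h.not_isPolynomial_iff, fun hnp ρ γ hρ hγ hργ hsupp => ?_⟩
  obtain ⟨S, M, hSM, hS, hM⟩ :=
    QuantumDivergence.exists_tendsto_stdDivPos_maxDivPos hf hc hnp hρ hγ hργ hsupp
  have hS' : Tendsto (QuantumDivergence.stdDivReg f ρ γ) (𝓝[>] 0) (𝓝 (S : EReal)) :=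
    (continuous_coe_real_ereal.tendsto S).comp hS
  have hM' : Tendsto (QuantumDivergence.maxDivReg f ρ γ) (𝓝[>] 0) (𝓝 (M : EReal)) :=
    (continuous_coe_real_ereal.tendsto M).comp hM
  rw [QuantumDivergence.stdDiv, QuantumDivergence.maxDiv, hS'.limUnder_eq, hM'.limUnder_eq]
  exact ⟨hS', hM', EReal.coe_lt_coe_iff.2 hSM⟩
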